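/- **Setting.** Let $I=[0,1]$. A $\Box$-set $X$ is a sequence of sets $X_n$ ($n\ge 0$) of $n$-cubes with face maps $d_i^\alpha:X_n\to X_{n-1}$ ($\alpha\in\{0,1\}$, $1\le i\le n$) such that $d_i^\alpha d_j^\beta=d_{j-1}^\beta d_i^\alpha$ for $i<j$; $|X|$ is its geometric realization, with points $[c;z]$, $c\in X_n$, $z\in I^n$. A partition $J=[J_0|J_*|J_1]$ of $\{1,\dots,n\}$ describes the face $\{0\}^{J_0}\times I^{J_*}\times\{1\}^{J_1}$ of $I^n$, with collar $C_J=[0,\frac12[^{J_0}\times I^{J_*}\times]\frac12,1]^{J_1}$; for $c\in X_n$ it gives an iterated face $d_Jc$ of $c$ ($c$ itself included). For a cube $d$ of $X$ let $C(d,X)\subseteq|X|$ be the set of all points $[c;z]$ with $z\in C_J$ for some $J$ such that $d_Jc$ is an iterated face of $d$; for a vertex $v$, $st(v)=C(v,X)$. $X$ is *proper* if there is at most one cube with given bottom and top vertices, and *non-self-linked* if for each $c\in X_n$ different $J$ give different faces $d_Jc$. Fix vertices $x^-,x^+\in X_0$. A *d-path* $p:I\to|X|$ from $x^-$ to $x^+$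 is a path with a presentation: a finite subdivision $0=t_0\le\dots\le t_l=1$, cubes $e_k$ and continuous, coordinatewise non-decreasing $\beta_k:[t_{k-1},t_k]\to I^{\dim e_k}$ with $p(t)=[e_k;\beta_k(t)]$. It is *strict* if one can choose a presentation such that each coordinate of each $\beta_k$ is injective except that it may rest at $0$ and at $1$; it is *tame* if one can choose a presentation such that all $p(t_k)$ are vertices. Let $\vec S$ and $\vec{ST}$ be the sets of strict, respectively strict and tame, d-paths from $x^-$ to $x^+$. A *cube chain* $\mathbf c=(c_1,\dots,c_n)$ from $x^-$ to $x^+$ is a sequence of cubes of positive dimension such that the bottom vertex of $c_1$ is $x^-$, the top vertex of each cube is the bottom vertex of the next one, and the top vertex of $c_n$ is $x^+$ (if $x^-=x^+$, the empty chain is included). An elementary refinement of $\mathbf c$ replaces one cube $c_i$, $m=\dim c_i$, by the two cubes $d_{[J|\{1,\dots,m\}\setminus J|\emptyset]}c_i$, $d_{[\emptyset|J|\{1,\dots,m\}\setminus J]}c_i$, where $\emptyset\ne J\subsetneq\{1,\dots,m\}$; refinement is the reflexive and transitive closure. A common refinement of $\mathbf c$ and $\mathbf c'$ is *coarsest* if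 every common refinement of $\mathbf c$ and $\mathbf c'$ refines it. **Collar path spaces.** Let $\vec P^C_{\mathbf c}$ be the set of d-paths $p$ from $x^-$ to $x^+$ for which there is a subdivision $0=s_0\le s_1\le\dots\le s_n=1$ such that on $[s_{i-1},s_i]$ the path $p$ runs in the collar of $c_i$ from the star of the bottom vertex of $c_i$ to the star of its top vertex (for the empty chain: $p$ runs in the star of $x^-$), in the following sense. For $z\in I^m$ let $\nu(z)$ be the smallest face of $I^m$ whose collar contains $z$. There are a presentation $(e_k,\beta_k)$ of $p$ on $[s_{i-1},s_i]$ and a function $F$ from $[s_{i-1},s_i]$ to the faces of $I^{\dim c_i}$, with $F(s_{i-1})$ and $F(s_i)$ the bottom and the top vertex, such that in each interval of the presentation, near each time, there are faces $J$ of $I^{\dim e_k}$ and $K$ of $I^{\dim c_i}$ with $d_Je_k=d_Kc_i$ for which $\beta_k(t)\in C_J$ and $F(t)$ is the subface of $K$ corresponding to the subface $\nu(\beta_k(t))$ of $J$ under the order-preserving identification of free coordinates. Put $\vec S^C_{\mathbf c}=\vec S\cap\vec P^C_{\mathbf c}$ and $\vec{ST}^C_{\mathbf c}=\vec{ST}\cap\vec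 P^C_{\mathbf c}$. For $p\in\vec S$, each point $p(t)=[c;z]$ determines the cube $\rho(p(t))=d_{\nu(z)}c$; let $c(p)$ be the sequence of the cubes $\rho(p(t))$, in the order of time, at the finitely many times $t$ at which $\rho(p(t))$ is not a vertex (i.e. $p$ meets a middle hyperplane $z_j=\frac12$). **Proposition.** Let $X$ be a $\Box$-set with vertices $x^-,x^+$. For all cube chains $\mathbf c,\mathbf c',\mathbf c''$ from $x^-$ to $x^+$: 1. $\mathbf c'$ refines $\mathbf c$ if and only if $\vec S^C_{\mathbf c'}\subseteq\vec S^C_{\mathbf c}$. 2. If $\mathbf c'$ refines $\mathbf c$ and $\mathbf c'\ne\mathbf c$, then $\vec S^C_{\mathbf c'}$ is a proper subset of $\vec S^C_{\mathbf c}$. 3. For every $p\in\vec S$, $c(p)$ is a cube chain from $x^-$ to $x^+$, $p\in\vec S^C_{c(p)}$, and $c(p)$ refines every cube chain $\mathbf c$ with $p\in\vec S^C_{\mathbf c}$. 4. $\vec S^C_{\mathbf c}\cap\vec S^C_{\mathbf c'}\ne\emptyset$ if and only if $\mathbf c$ and $\mathbf c'$ have a common refinement. 5. If $\mathbf c''$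 is a common refinement of $\mathbf c$ and $\mathbf c'$, then $\vec S^C_{\mathbf c''}\subseteq\vec S^C_{\mathbf c}\cap\vec S^C_{\mathbf c'}$. If $\mathbf c''$ is a coarsest common refinement, equality holds. 6. If $X$ is proper and non-self-linked, then $\mathbf c$ and $\mathbf c'$ either have no common refinement or have a coarsest common refinement $\mathbf c''$, and then $\vec S^C_{\mathbf c''}=\vec S^C_{\mathbf c}\cap\vec S^C_{\mathbf c'}$. 7. Assertions 1 to 6 also hold with $\vec S$ replaced by $\vec{ST}$ throughout. Moreover, if $X$ is non-self-linked, then $\vec P^C_{\mathbf c}$ is the set of d-paths $p$ from $x^-$ to $x^+$ for which there is a subdivision $0=s_0\le\dots\le s_n=1$ with $p([s_{i-1},s_i])\subseteq C(c_i,X)$, $p(s_{i-1})\in st(\text{bottom vertex of }c_i)$ and $p(s_i)\in st(\text{top vertex of }c_i)$ for all $i$ (for the empty chain: $p(I)\subseteq st(x^-)$). -/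

import Mathlib

open Set Filter Topology
open scoped unitInterval

universe u

/-- A `□`-set (pre-cubical set): `face α i` is the face map `d_i^α`, with `i` counted from `0`,
`α = false` standing for `0` and `α = true` for `1`. -/
structure PrecubicalSet where
  cube : ℕ → Type u
  face : ∀ {n : ℕ}, Bool → Fin (n + 1) → cube (n + 1) → cube n
  face_face : ∀ {n : ℕ} (α β : Bool) (i j : Fin (n + 1)), i ≤ j → ∀ c : cube (n + 2),
    face α i (face β j.succ c) = face β j (face α i.castSucc c)

/-- A face of the cube `I^n`, i.e. a partition `[1:n] = J₀ ⊔ J_* ⊔ J₁`: the value `some false`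
marks `J₀`, the value `some true` marks `J₁`, and `none` marks the free coordinates `J_*`. -/
abbrev CubeFace (n : ℕ) : Type := Fin n → Option Bool

namespace CubeFace

/-- The vertex of `I^n` all of whose coordinates are `α`. -/
def corner (n : ℕ) (α : Bool) : CubeFace n := fun _ => some α

/-- The open collar `C_{[J₀|J_*|J₁]} I^n = [0,1/2[^{J₀} × I^{J_*} × ]1/2,1]^{J₁}`. -/
def collar {n : ℕ} (J : CubeFace n) : Set (Fin n → I) :=
  {x | ∀ i, (J i = some false → (x i : ℝ) < 1 / 2) ∧ (J i = some true → 1 / 2 < (x i : ℝ))}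

open Classical in
/-- The smallest face of `I^n` whose collar contains `x`: coordinates below `1/2` belong to `J₀`,
those above `1/2` to `J₁`, those equal to `1/2` are free. -/
noncomputable def nearest {n : ℕ} (x : Fin n → I) : CubeFace n := fun i =>
  if (x i : ℝ) < 1 / 2 then some false else if 1 / 2 < (x i : ℝ) then some true else none

/-- If the faces `J` of `I^m` and `K` of `I^n` have the same dimension, they are identified through
the order preserving bijection `φ` of their free coordinates; `transfer` is the resulting map from
subfaces of `J` to subfaces of `K`. -/
def transfer {m n : ℕ} (J : CubeFace m) (K : CubeFace n)
    (φ : {j : Fin m // J j = none} ≃o {i : Fin n // K i = none}) (G : CubeFace m) : CubeFace n :=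
  fun i => if h : K i = none then G (φ.symm ⟨i, h⟩) else K i

end CubeFace

namespace PrecubicalSet

/-- The cubes of `X` of all dimensions. -/
abbrev Cell (X : PrecubicalSet.{u}) : Type u := Σ n : ℕ, X.cube n

/-- The `□`-set whose `n`-cubes are the `(n+1)`-cubes of `X`, forgetting the two face maps in the
first direction. -/
abbrev shift (X : PrecubicalSet.{u}) : PrecubicalSet.{u} where
  cube n := X.cube (n + 1)
  face α i c := X.face α i.succ c
  face_face α β i j h c := by
    simpa using X.face_face α β i.succ j.succ (Fin.succ_le_succ_iff.mpr h) c

/-- The iterated face `d_{[J₀|J_*|J₁]} c`. Coordinates are processed from the first one on: a fixed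
coordinate is removed by the corresponding face map, a free one is kept. -/
def iterFace : (X : PrecubicalSet.{u}) → {n : ℕ} → CubeFace n → X.cube n → X.Cell
  | _, 0, _, c => ⟨0, c⟩
  | X, n + 1, J, c =>
    match J 0 with
    | some α => iterFace X (fun i : Fin n => J i.succ) (X.face α 0 c)
    | none =>
      let r := iterFace X.shift (n := n) (fun i : Fin n => J i.succ) c
      ⟨r.1 + 1, r.2⟩

/-- The source vertex (`α = false`) and the target vertex (`α = true`) of a cube. -/
def endVertex (X : PrecubicalSet.{u}) (α : Bool) : {n : ℕ} → X.cube n → X.cube 0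
  | 0, c => c
  | _ + 1, c => endVertex X α (X.face α 0 c)

/-- At most one cube with given source and target vertex. -/
def IsProper (X : PrecubicalSet.{u}) : Prop :=
  ∀ c d : X.Cell, X.endVertex false c.2 = X.endVertex false d.2 →
    X.endVertex true c.2 = X.endVertex true d.2 → c = d

/-- Different faces of `I^n` give different iterated faces of each `n`-cube. -/
def NonSelfLinked (X : PrecubicalSet.{u}) : Prop :=
  ∀ (n : ℕ) (c : X.cube n), Function.Injective fun J : CubeFace n => X.iterFace J c

/-! Geometric realization -/

/-- The gluing relation `[d_i^α c, x] ~ [c, δ_i^α x]` on the disjoint union of all cubes. -/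
inductive Glue (X : PrecubicalSet.{u}) :
    (Σ c : X.Cell, (Fin c.1 → I)) → (Σ c : X.Cell, (Fin c.1 → I)) → Prop
  | glue {n : ℕ} (c : X.cube (n + 1)) (i : Fin (n + 1)) (α : Bool) (x : Fin n → I) :
      Glue X ⟨⟨n, X.face α i c⟩, x⟩
        ⟨⟨n + 1, c⟩, i.insertNth (α := fun _ => I) (if α then 1 else 0) x⟩

/-- The geometric realization with the quotient topology. -/
def Realization (X : PrecubicalSet.{u}) : Type u := Quot X.Glue

instance (X : PrecubicalSet.{u}) : TopologicalSpace X.Realization :=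
  inferInstanceAs (TopologicalSpace (Quot X.Glue))

/-- The point `[c; x]`. -/
def pt (X : PrecubicalSet.{u}) {n : ℕ} (c : X.cube n) (x : Fin n → I) : X.Realization :=
  Quot.mk _ ⟨⟨n, c⟩, x⟩

/-- A vertex as a point of the realization. -/
def vertexPt (X : PrecubicalSet.{u}) (v : X.cube 0) : X.Realization := X.pt v Fin.elim0

theorem iterFace_fixed (X : PrecubicalSet.{u}) {n : ℕ} (J : CubeFace (n + 1)) (c : X.cube (n + 1))
    (α : Bool) (h : J 0 = some α) :
    X.iterFace J c = X.iterFace (fun i : Fin n => J i.succ) (X.face α 0 c) := by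
  rw [iterFace, h]

theorem iterFace_free (X : PrecubicalSet.{u}) {n : ℕ} (J : CubeFace (n + 1)) (c : X.cube (n + 1))
    (h : J 0 = none) :
    X.iterFace J c = ⟨(X.shift.iterFace (n := n) (fun i : Fin n => J i.succ) c).1 + 1,
      (X.shift.iterFace (n := n) (fun i : Fin n => J i.succ) c).2⟩ := by
  rw [iterFace, h]

/-- Fixed coordinates may be removed in any order. -/
theorem iterFace_remove : ∀ (X : PrecubicalSet.{u}) {n : ℕ} (J : CubeFace (n + 1))
    (c : X.cube (n + 1)) (i : Fin (n + 1)) (α : Bool), J i = some α →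
    X.iterFace J c = X.iterFace (fun k => J (i.succAbove k)) (X.face α i c) := by
  intro X n
  induction n generalizing X with
  | zero =>
    intro J c i α h
    obtain rfl : i = 0 := Fin.fin_one_eq_zero i
    exact X.iterFace_fixed J c α h
  | succ n ih =>
    intro J c i α h
    revert h
    refine Fin.cases (fun h => ?_) (fun j h => ?_) i
    · simpa using X.iterFace_fixed J c α h
    · have h0 : (j.succ).succAbove (0 : Fin (n + 1)) = 0 := by simp
      have hs : (fun k : Fin n => J (j.succ.succAbove k.succ))
          = fun k => J (j.succAbove k).succ := by
        funext k; rw [Fin.succ_succAbove_succ]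
      cases hJ : J 0 with
      | some β =>
        rw [X.iterFace_fixed J c β hJ, X.iterFace_fixed _ (X.face α j.succ c) β (by rw [h0, hJ]),
          ih X _ (X.face β 0 c) j α h, X.face_face β α 0 j (Fin.zero_le _) c, hs,
          Fin.castSucc_zero]
      | none =>
        rw [X.iterFace_free J c hJ, X.iterFace_free _ (X.face α j.succ c) (by rw [h0, hJ]),
          ih X.shift _ c j α h, hs]

/-- The smallest cube of `X` whose collar contains a given point of the realization. -/
noncomputable def nearestFace (X : PrecubicalSet.{u}) : X.Realization → X.Cell :=
  Quot.lift (fun y => X.iterFace (CubeFace.nearest y.2) y.1.2) (by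
    rintro _ _ ⟨c, i, α, x⟩
    have h : CubeFace.nearest (i.insertNth (α := fun _ => I) (if α then 1 else 0) x) i
        = some α := by
      cases α <;> norm_num [CubeFace.nearest]
    refine Eq.symm ((X.iterFace_remove _ c i α h).trans ?_)
    congr 1
    funext k
    simp [CubeFace.nearest])

/-- The collar `C(d, X)`: the union of the sets `C_J c` over all cubes `c` and all faces `J` such
that `d_J c` is an iterated face of `d` (or `d` itself). For a vertex `d` it is the star of `d`. -/
def collar (X : PrecubicalSet.{u}) (d : X.Cell) : Set X.Realization :=
  {y | ∃ (n : ℕ) (c : X.cube n) (J : CubeFace n) (x : Fin n → I),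
    y = X.pt c x ∧ x ∈ CubeFace.collar J ∧ ∃ K : CubeFace d.1, X.iterFace J c = X.iterFace K d.2}

/-- The star of a vertex. -/
def star (X : PrecubicalSet.{u}) (v : X.cube 0) : Set X.Realization := X.collar ⟨0, v⟩

/-! Directed paths -/

/-- A presentation `[c₁;β₁] *_{t₁} [c₂;β₂] * ⋯ * [c_l;β_l]` of `p` on the interval `[a, b]`, with
increasing paths `β_k` in cubes. -/
structure Presentation (X : PrecubicalSet.{u}) (p : I → X.Realization) (a b : I) where
  len : ℕ
  time : Fin (len + 1) → I
  time_mono : Monotone time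
  time_zero : time 0 = a
  time_last : time (Fin.last len) = b
  dim : Fin len → ℕ
  cube : ∀ k, X.cube (dim k)
  path : ∀ k, I → (Fin (dim k) → I)
  path_cont : ∀ k, ContinuousOn (path k) (Icc (time k.castSucc) (time k.succ))
  path_mono : ∀ k, MonotoneOn (path k) (Icc (time k.castSucc) (time k.succ))
  eq_pt : ∀ k, ∀ t ∈ Icc (time k.castSucc) (time k.succ), p t = X.pt (cube k) (path k t)

/-- All the paths `β_k` are strictly increasing: a coordinate may rest only at `0` or `1`. -/
def Presentation.IsStrict {X : PrecubicalSet.{u}} {p : I → X.Realization} {a b : I}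
    (P : X.Presentation p a b) : Prop :=
  ∀ (k : Fin P.len) (i : Fin (P.dim k)),
    ∀ s ∈ Icc (P.time k.castSucc) (P.time k.succ), ∀ t ∈ Icc (P.time k.castSucc) (P.time k.succ),
      P.path k s i = P.path k t i → s = t ∨ P.path k s i = 0 ∨ P.path k s i = 1

/-- All the subdivision points are mapped to vertices. -/
def Presentation.IsTame {X : PrecubicalSet.{u}} {p : I → X.Realization} {a b : I}
    (P : X.Presentation p a b) : Prop :=
  ∀ k, ∃ v : X.cube 0, p (P.time k) = X.vertexPt v

/-- The directed paths from the vertex `x` to the vertex `y`. -/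
def dPaths (X : PrecubicalSet.{u}) (x y : X.cube 0) : Set C(I, X.Realization) :=
  {p | p 0 = X.vertexPt x ∧ p 1 = X.vertexPt y ∧ Nonempty (X.Presentation p 0 1)}

/-- The strictly directed paths from `x` to `y`. -/
def strictPaths (X : PrecubicalSet.{u}) (x y : X.cube 0) : Set C(I, X.Realization) :=
  {p | p ∈ X.dPaths x y ∧ ∃ P : X.Presentation p 0 1, P.IsStrict}

/-- The tame directed paths from `x` to `y`. -/
def tamePaths (X : PrecubicalSet.{u}) (x y : X.cube 0) : Set C(I, X.Realization) :=
  {p | p ∈ X.dPaths x y ∧ ∃ P : X.Presentation p 0 1, P.IsTame}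

/-- The strictly directed and tame paths from `x` to `y`. -/
def strictTamePaths (X : PrecubicalSet.{u}) (x y : X.cube 0) : Set C(I, X.Realization) :=
  X.strictPaths x y ∩ X.tamePaths x y

/-! Cube chains and refinement -/

/-- The cubes of the list are consecutive and lead from `x` to `y`. -/
def Linked (X : PrecubicalSet.{u}) : X.cube 0 → List X.Cell → X.cube 0 → Prop
  | x, [], y => x = y
  | x, c :: cs, y => X.endVertex false c.2 = x ∧ X.Linked (X.endVertex true c.2) cs y

/-- Cube chains from `x` to `y`. If `x = y` there is the empty chain. -/
@[ext] structure CubeChain (X : PrecubicalSet.{u}) (x y : X.cube 0) where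
  cubes : List X.Cell
  dim_pos : ∀ c ∈ cubes, 0 < c.1
  linked : X.Linked x cubes y

open Classical in
/-- The face `d_{[J|[1:n]∖J|∅]} e`. -/
noncomputable def splitFirst (X : PrecubicalSet.{u}) {n : ℕ} (J : Set (Fin n)) (e : X.cube n) :
    X.Cell :=
  X.iterFace (fun i => if i ∈ J then some false else none) e

open Classical in
/-- The face `d_{[∅|J|[1:n]∖J]} e`. -/
noncomputable def splitSecond (X : PrecubicalSet.{u}) {n : ℕ} (J : Set (Fin n)) (e : X.cube n) :
    X.Cell :=
  X.iterFace (fun i => if i ∈ J then none else some true) e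

namespace CubeChain

variable {X : PrecubicalSet.{u}} {x y : X.cube 0}

/-- `c'` arises from `c` by replacing one cube by one of its elementary refinements. -/
def ElementaryRefines (c' c : X.CubeChain x y) : Prop :=
  ∃ (L R : List X.Cell) (n : ℕ) (e : X.cube n) (J : Set (Fin n)),
    J ≠ ∅ ∧ J ≠ univ ∧ c.cubes = L ++ ⟨n, e⟩ :: R ∧
      c'.cubes = L ++ X.splitFirst J e :: X.splitSecond J e :: R

/-- `c'` refines `c`: reflexive and transitive closure of elementary refinement. -/
def Refines (c' c : X.CubeChain x y) : Prop :=
  Relation.ReflTransGen (fun d d' : X.CubeChain x y => d'.ElementaryRefines d) c c'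

/-- `d` is a common refinement of `c` and `c'`. -/
def IsCommonRefinement (d c c' : X.CubeChain x y) : Prop := d.Refines c ∧ d.Refines c'

/-- `d` is a coarsest common refinement of `c` and `c'`. -/
def IsCoarsestCommonRefinement (d c c' : X.CubeChain x y) : Prop :=
  d.IsCommonRefinement c c' ∧ ∀ e : X.CubeChain x y, e.IsCommonRefinement c c' → e.Refines d

/-- The cubes of a chain; the empty chain from `x` to `x` is represented by the `0`-cube `x`. -/
def pieces (c : X.CubeChain x y) : List X.Cell :=
  match c.cubes with
  | [] => [⟨0, x⟩]
  | e :: es => e :: es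

end CubeChain

/-! Paths subordinate to the collar of a cube chain -/

/-- On the interval `[a, b]`, the path `p` is a directed path in the collar of the cube `e`, from the
star of the source vertex of `e` to the star of its target vertex.

In a self-linked `□`-set different faces of `I^n` may give the same iterated face of `e`, so it has
to be recorded which face of `I^n` the path is close to: `F t` is this face at time `t`. Near every
time, `p` runs in the collar `C_J c_k` of an iterated face `d_J c_k = d_K e`, and `F` is given by the
smallest subface of `J` whose collar contains the path `β_k`. -/
def RunsInCollar (X : PrecubicalSet.{u}) (p : I → X.Realization) (e : X.Cell) (a b : I) : Prop :=
  ∃ (P : X.Presentation p a b) (F : I → CubeFace e.1),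
    F a = CubeFace.corner e.1 false ∧ F b = CubeFace.corner e.1 true ∧
    ∀ (k : Fin P.len), ∀ s ∈ Icc (P.time k.castSucc) (P.time k.succ),
      ∃ (J : CubeFace (P.dim k)) (K : CubeFace e.1)
        (φ : {j : Fin (P.dim k) // J j = none} ≃o {i : Fin e.1 // K i = none}),
        X.iterFace J (P.cube k) = X.iterFace K e.2 ∧
        ∀ᶠ t in 𝓝[Icc (P.time k.castSucc) (P.time k.succ)] s,
          P.path k t ∈ CubeFace.collar J ∧
            F t = CubeFace.transfer J K φ (CubeFace.nearest (P.path k t))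

/-- On `[a, b]`, the path `p` takes its values in the subset `C(e, X)` of the realization, starts in
the star of the source vertex of `e` and ends in the star of its target vertex. -/
def StaysInCollar (X : PrecubicalSet.{u}) (p : I → X.Realization) (e : X.Cell) (a b : I) : Prop :=
  (∀ t ∈ Icc a b, p t ∈ X.collar e) ∧ p a ∈ X.star (X.endVertex false e.2) ∧
    p b ∈ X.star (X.endVertex true e.2)

/-- `[a, b]` has a subdivision into intervals, one for each cube of the list, on which `Q` holds. -/
def Concatenates {X : PrecubicalSet.{u}} (Q : X.Cell → I → I → Prop) : List X.Cell → I → I → Prop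
  | [], a, b => a = b
  | e :: es, a, b => ∃ t, a ≤ t ∧ t ≤ b ∧ Q e a t ∧ Concatenates Q es t b

/-- The directed paths from `x` to `y` subordinate to the collar of the chain `c`. -/
def collarPaths (X : PrecubicalSet.{u}) {x y : X.cube 0} (c : X.CubeChain x y) :
    Set C(I, X.Realization) :=
  {p | p ∈ X.dPaths x y ∧ Concatenates (X.RunsInCollar p) c.pieces 0 1}

/-- The directed paths from `x` to `y` that are concatenations of paths in the subsets `C(c_i, X)`
of the realization, with subdivision points in the stars of the vertices of the chain `c`. -/
def plainCollarPaths (X : PrecubicalSet.{u}) {x y : X.cube 0} (c : X.CubeChain x y) :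
    Set C(I, X.Realization) :=
  {p | p ∈ X.dPaths x y ∧ Concatenates (X.StaysInCollar p) c.pieces 0 1}

/-- The times at which `p` meets a middle hyperplane `x_i = 1/2` of some cube. -/
def crossingTimes (X : PrecubicalSet.{u}) (p : I → X.Realization) : Set I :=
  {t | 0 < (X.nearestFace (p t)).1}

open Classical in
/-- The cubes of the chain `c(p)`: at each of the finitely many times at which the strict path `p`
meets a middle hyperplane, take the smallest cube whose collar contains the point of `p`. -/
noncomputable def crossingCubes (X : PrecubicalSet.{u}) (p : I → X.Realization) : List X.Cell :=
  if h : (X.crossingTimes p).Finite then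
    (h.toFinset.sort (· ≤ ·)).map fun t => X.nearestFace (p t)
  else []

end PrecubicalSet

/-! Call the map sending `t` to the smallest cube whose collar contains `p t` the trace of `p`. A
coordinate of a strict path cannot rest at `1/2`, so the trace is a step function: just after each
time it is the target, just before it the source, of its current value. By compactness only finitely
many values have positive dimension, and these form a cube chain `c(p)`.

The assertions on inclusions and intersections follow from two facts. First, a strict path `p` lies
in the collar path space of `c` if and only if `c(p)` refines `c` (`mem_collarPaths_iff`). Second,
every chain is `c(p)` for some strict and tame path, a concatenation of diagonals of its cubes
(`exists_strictTamePath`). Hence collar path spaces are ordered exactly as chains are under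
refinement, and antisymmetry of refinement makes the inclusions proper.

For the first fact, refinement gets a non-inductive description: a list refines a cube `e` if it is
the image of a chain of faces of `I^n` from the bottom to the top corner (`RefinesCell`,
`CubeChain.refines_iff`). The face-valued function `F` recorded by `RunsInCollar` traces out such a
chain; conversely such a chain lifts the trace to a function `F` (`steps_exists_lift`). Chains and
step functions thus occur both for faces of `I^n` and for cubes of `X`, which is why they are set up
over `HasEnds`.

In a proper `□`-set a cube is determined by its ends. All common refinements of two chains must
therefore cut the larger of the two first cubes in the same way, and a coarsest one is built by
induction (`IsProper.hasCoarsest`). -/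

/-- Types of cells with a source and a target, both of which are vertices, i.e. cells that are
their own source. -/
class HasEnds (C : Type*) where
  src : C → C
  tgt : C → C
  src_src : ∀ c, src (src c) = src c
  src_tgt : ∀ c, src (tgt c) = tgt c
  tgt_of_src : ∀ c, src c = c → tgt c = c

namespace HasEnds

variable {C D : Type*} [HasEnds C] [HasEnds D]

theorem tgt_tgt (c : C) : tgt (tgt c) = tgt c := tgt_of_src _ (src_tgt c)

theorem tgt_src (c : C) : tgt (src c) = src c := tgt_of_src _ (src_src c)

/-- Chains of cells of positive dimension from the vertex `u` to the vertex `v`. -/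
def Chain : C → List C → C → Prop
  | u, [], v => u = v
  | u, c :: cs, v => src c ≠ c ∧ src c = u ∧ Chain (tgt c) cs v

theorem chain_nil {u v : C} : Chain u [] v ↔ u = v := Iff.rfl

theorem chain_cons {u v c : C} {cs : List C} :
    Chain u (c :: cs) v ↔ src c ≠ c ∧ src c = u ∧ Chain (tgt c) cs v := Iff.rfl

theorem chain_append {u v : C} {l l' : List C} :
    Chain u (l ++ l') v ↔ ∃ m, Chain u l m ∧ Chain m l' v := by
  induction l generalizing u with
  | nil => simp [chain_nil]
  | cons c cs ih => simp only [List.cons_append, chain_cons, ih]; grind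

theorem Chain.map {u v : C} {l : List C} (h : Chain u l v) (f : C → D)
    (hs : ∀ c ∈ l, f (src c) = src (f c)) (ht : ∀ c ∈ l, f (tgt c) = tgt (f c))
    (hv : ∀ c ∈ l, src c ≠ c → src (f c) ≠ f c) : Chain (f u) (l.map f) (f v) := by
  induction l generalizing u with
  | nil => exact congrArg f h
  | cons c cs ih =>
    obtain ⟨h1, rfl, h3⟩ := h
    refine ⟨hv c (by simp) h1, (hs c (by simp)).symm, ?_⟩
    rw [← ht c (by simp)]
    exact ih h3 (fun c hc => hs c (by simp [hc])) (fun c hc => ht c (by simp [hc]))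
      (fun c hc => hv c (by simp [hc]))

theorem Chain.src_ne {u v : C} {l : List C} (h : Chain u l v) {c : C} (hc : c ∈ l) :
    src c ≠ c := by
  induction l generalizing u with
  | nil => simp at hc
  | cons d cs ih =>
    rcases List.mem_cons.mp hc with rfl | hc
    · exact h.1
    · exact ih h.2.2 hc

theorem Chain.src_right {u v : C} {l : List C} (h : Chain u l v) (hu : src u = u) :
    src v = v := by
  induction l generalizing u with
  | nil => rw [← chain_nil.mp h, hu]
  | cons c cs ih => exact ih h.2.2 (src_tgt c)

theorem Chain.unique_right {u v w : C} {l : List C} (h : Chain u l v) (h' : Chain u l w) :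
    v = w := by
  induction l generalizing u with
  | nil => exact (chain_nil.mp h).symm.trans h'
  | cons c cs ih => exact ih h.2.2 h'.2.2

theorem Chain.unique_left {u v u' v' : C} {l : List C} (h : Chain u l v) (h' : Chain u' l v')
    (hl : l ≠ []) : u = u' := by
  cases l with
  | nil => exact absurd rfl hl
  | cons c cs => exact h.2.1.symm.trans h'.2.1

end HasEnds

open HasEnds

instance {n : ℕ} : HasEnds (CubeFace n) where
  src G i := some ((G i).getD false)
  tgt G i := some ((G i).getD true)
  src_src _ := rfl
  src_tgt _ := rfl
  tgt_of_src G h := by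
    funext i
    have := congrFun h i
    cases hG : G i <;> simp_all

instance (X : PrecubicalSet.{u}) : HasEnds X.Cell where
  src c := ⟨0, X.endVertex false c.2⟩
  tgt c := ⟨0, X.endVertex true c.2⟩
  src_src _ := rfl
  src_tgt _ := rfl
  tgt_of_src := by
    rintro ⟨n, c⟩ h
    have : n = 0 := (congrArg Sigma.fst h).symm
    subst this
    rfl

/-! ### Faces of the standard cube -/

namespace CubeFace

variable {n : ℕ}

theorem src_apply (G : CubeFace n) (i : Fin n) : src G i = some ((G i).getD false) := rfl

theorem tgt_apply (G : CubeFace n) (i : Fin n) : tgt G i = some ((G i).getD true) := rfl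

theorem src_eq_self_iff {G : CubeFace n} : src G = G ↔ ∀ i, G i ≠ none := by
  constructor
  · intro h i hi
    have := congrFun h i
    rw [src_apply, hi] at this
    cases this
  · intro h
    funext i
    rw [src_apply]
    cases hG : G i with
    | none => exact absurd hG (h i)
    | some α => rfl

/-- `G` is a face of the face `J`. -/
def IsSubface (G J : CubeFace n) : Prop := ∀ i α, J i = some α → G i = some α

theorem IsSubface.refl (J : CubeFace n) : J.IsSubface J := fun _ _ h => h

theorem src_isSubface (J : CubeFace n) : IsSubface (src J) J := fun i α h => by
  rw [src_apply, h]; rfl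

theorem tgt_isSubface (J : CubeFace n) : IsSubface (tgt J) J := fun i α h => by
  rw [tgt_apply, h]; rfl

/-- Converts the inequalities defining a collar into combinatorics of nearest faces. -/
theorem mem_collar_iff {J : CubeFace n} {x : Fin n → I} :
    x ∈ collar J ↔ (nearest x).IsSubface J := by
  constructor
  · rintro h i (_ | _) hα
    · rw [nearest, if_pos ((h i).1 hα)]
    · rw [nearest, if_neg ((h i).2 hα).not_gt, if_pos ((h i).2 hα)]
  · intro h i
    refine ⟨fun hJ => ?_, fun hJ => ?_⟩ <;>
    · have := h i _ hJ
      unfold nearest at this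
      grind

theorem exists_orderIso_free {m : ℕ} {J : CubeFace n}
    (h : m = Fintype.card {j : Fin n // J j = none}) :
    Nonempty (Fin m ≃o {j : Fin n // J j = none}) :=
  ⟨Fintype.orderIsoFinOfCardEq _ h.symm⟩

end CubeFace

/-! ### Iterated faces and their composition -/

namespace PrecubicalSet

variable (X : PrecubicalSet.{u})

variable {X} in
theorem src_eq_self_iff {c : X.Cell} : src c = c ↔ c.1 = 0 := by
  constructor
  · intro h
    exact (congrArg Sigma.fst h).symm
  · obtain ⟨n, c⟩ := c
    rintro rfl
    rfl

variable {X} in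
theorem src_ne_self_iff {c : X.Cell} : src c ≠ c ↔ 0 < c.1 := by
  rw [Ne, src_eq_self_iff, Nat.pos_iff_ne_zero]

/-- Iterated faces are natural. -/
theorem iterFace_map : ∀ {n : ℕ} (X Y : PrecubicalSet.{u}) (f : ∀ k, X.cube k → Y.cube k)
    (_ : ∀ (k : ℕ) (α : Bool) (i : Fin (k + 1)) (c : X.cube (k + 1)),
      f k (X.face α i c) = Y.face α i (f (k + 1) c))
    (J : CubeFace n) (c : X.cube n),
    Y.iterFace J (f n c) = ⟨(X.iterFace J c).1, f _ (X.iterFace J c).2⟩ := by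
  intro n
  induction n with
  | zero => intro X Y f hf J c; rfl
  | succ n ih =>
    intro X Y f hf J c
    cases hJ : J 0 with
    | some α =>
      rw [Y.iterFace_fixed J _ α hJ, X.iterFace_fixed J _ α hJ, ← hf, ih X Y f hf]
    | none =>
      rw [Y.iterFace_free J _ hJ, X.iterFace_free J _ hJ]
      have := ih X.shift Y.shift (fun k => f (k + 1)) (fun k α i c => hf _ α i.succ c)
        (fun i => J i.succ) c
      rw [this]

/-- By the identity for iterated face maps, `face α 0` is a morphism from `X.shift` to `X`, so
naturality of iterated faces applies. -/
theorem iterFace_face_zero {n : ℕ} (J : CubeFace n) (c : X.cube (n + 1)) (α : Bool) :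
    X.iterFace J (X.face α 0 c)
      = ⟨(X.shift.iterFace J c).1, X.face α 0 (X.shift.iterFace J c).2⟩ :=
  iterFace_map X.shift X (fun _ d => X.face α 0 d)
    (fun k β i c => by simpa using X.face_face α β 0 i (Fin.zero_le _) c) J c

theorem iterFace_fst : ∀ {n : ℕ} (X : PrecubicalSet.{u}) (J : CubeFace n) (c : X.cube n),
    (X.iterFace J c).1 = Fintype.card {j : Fin n // J j = none} := by
  intro n
  induction n with
  | zero => intro X J c; simp [iterFace]
  | succ n ih =>
    intro X J c
    have hcard : Fintype.card {j : Fin (n + 1) // J j = none}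
        = (if J 0 = none then 1 else 0) + Fintype.card {j : Fin n // J j.succ = none} := by
      simp only [Fintype.card_subtype, Finset.card_filter, Fin.sum_univ_succ]
    cases hJ : J 0 with
    | some α => rw [X.iterFace_fixed J _ α hJ, ih, hcard]; simp [hJ]
    | none => rw [X.iterFace_free J _ hJ, hcard]; simp [hJ, ih, add_comm]

theorem iterFace_none : ∀ {n : ℕ} (X : PrecubicalSet.{u}) (c : X.cube n),
    X.iterFace (fun _ => none) c = ⟨n, c⟩ := by
  intro n
  induction n with
  | zero => intro X c; rfl
  | succ n ih =>
    intro X c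
    rw [X.iterFace_free _ _ rfl, ih]

theorem iterFace_corner (α : Bool) : ∀ {n : ℕ} (c : X.cube n),
    X.iterFace (CubeFace.corner n α) c = ⟨0, X.endVertex α c⟩ := by
  intro n
  induction n with
  | zero => intro c; rfl
  | succ n ih =>
    intro c
    rw [X.iterFace_fixed _ _ α rfl]
    exact ih _

/-- Induction on the first coordinate. The enumeration `ψ` of the free coordinates of `J` is
arbitrary, so that it can be replaced by its shifted version in the inductive step. -/
theorem iterFace_comp_aux : ∀ {n : ℕ} (X : PrecubicalSet.{u}) (J G : CubeFace n) (_ : G.IsSubface J)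
    (c : X.cube n) (ψ : Fin (X.iterFace J c).1 → Fin n) (_ : StrictMono ψ)
    (_ : ∀ j, j ∈ range ψ ↔ J j = none),
    X.iterFace G c = X.iterFace (fun k => G (ψ k)) (X.iterFace J c).2 := by
  intro n
  induction n with
  | zero => intro X J G hG c ψ hψ hr; rfl
  | succ n ih =>
    intro X J G hG c ψ hψ hr
    cases hJ : J 0 with
    | some α =>
      -- The domain of `ψ` depends on the iterated face, which blocks rewriting; a variable cell `d`
      -- takes its place.
      have key : ∀ (d : X.Cell) (hd : X.iterFace (fun i => J i.succ) (X.face α 0 c) = d)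
          (ψ : Fin d.1 → Fin (n + 1)) (_ : StrictMono ψ) (_ : ∀ j, j ∈ range ψ ↔ J j = none),
          X.iterFace G c = X.iterFace (fun k => G (ψ k)) d.2 := by
        rintro d rfl ψ hψ hr
        have h0 : ∀ k, ψ k ≠ 0 := fun k hk => by
          have := (hr 0).1 ⟨k, hk⟩
          rw [hJ] at this; cases this
        rw [X.iterFace_fixed G c α (hG 0 α hJ),
          ih X (fun i => J i.succ) (fun i => G i.succ) (fun i => hG i.succ) _
            (fun k => (ψ k).pred (h0 k)) (fun a b hab => Fin.pred_lt_pred_iff.2 (hψ hab))]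
        · simp
        · intro j
          rw [← hr j.succ]
          constructor
          · rintro ⟨k, rfl⟩; exact ⟨k, by simp⟩
          · rintro ⟨k, hk⟩; exact ⟨k, by simp [hk]⟩
      exact key _ (X.iterFace_fixed J c α hJ).symm ψ hψ hr
    | none =>
      have key : ∀ (d : X.Cell) (hd : (⟨(X.shift.iterFace (n := n) (fun i => J i.succ) c).1 + 1,
          (X.shift.iterFace (n := n) (fun i => J i.succ) c).2⟩ : X.Cell) = d)
          (ψ : Fin d.1 → Fin (n + 1)) (_ : StrictMono ψ) (_ : ∀ j, j ∈ range ψ ↔ J j = none),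
          X.iterFace G c = X.iterFace (fun k => G (ψ k)) d.2 := by
        rintro d rfl ψ hψ hr
        dsimp only at ψ hψ hr ⊢
        obtain ⟨k0, hk0⟩ := (hr 0).2 hJ
        have hψ0 : ψ 0 = 0 := by
          have : ψ 0 ≤ ψ k0 := hψ.monotone (Fin.zero_le _)
          rw [hk0] at this
          exact Fin.le_zero_iff.1 this
        have h0 : ∀ k : Fin (X.shift.iterFace (n := n) (fun i => J i.succ) c).1,
            ψ k.succ ≠ 0 := fun k hk => by
          have := hψ.injective (hk.trans hψ0.symm)
          exact Fin.succ_ne_zero _ this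
        have hm : StrictMono fun k => (ψ k.succ).pred (h0 k) :=
          fun a b hab => Fin.pred_lt_pred_iff.2 (hψ (Fin.succ_lt_succ_iff.2 hab))
        have hr' : ∀ j : Fin n, j ∈ range (fun k => (ψ k.succ).pred (h0 k)) ↔ J j.succ = none := by
          intro j
          rw [← hr j.succ]
          constructor
          · rintro ⟨k, rfl⟩; exact ⟨k.succ, by simp⟩
          · rintro ⟨k, hk⟩
            revert hk
            refine Fin.cases (fun hk => ?_) (fun k hk => ?_) k
            · rw [hψ0] at hk; exact absurd hk.symm (Fin.succ_ne_zero _)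
            · exact ⟨k, by simp [hk]⟩
        cases hG0 : G 0 with
        | none =>
          rw [X.iterFace_free G c hG0, X.iterFace_free _ _ (by rw [hψ0, hG0]),
            ih X.shift (fun i => J i.succ) (fun i => G i.succ) (fun i => hG i.succ) c _ hm hr']
          have : (fun k => G ((ψ k.succ).pred (h0 k)).succ) = fun k => G (ψ k.succ) := by
            funext k; rw [Fin.succ_pred]
          rw [this]
        | some β =>
          -- Here `J` keeps the first coordinate and `G` fixes it, so the face map in that direction
          -- has to be moved past the iterated face of the shifted set.
          have e := X.iterFace_face_zero (fun i => J i.succ) c β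
          rw [X.iterFace_fixed G c β hG0, X.iterFace_fixed _ _ β (by rw [hψ0, hG0])]
          have key2 : ∀ (d : X.Cell) (hd : X.iterFace (fun i => J i.succ) (X.face β 0 c) = d)
              (ψ : Fin d.1 → Fin n) (_ : StrictMono ψ)
              (_ : ∀ j, j ∈ range ψ ↔ J j.succ = none),
              X.iterFace (fun i => G i.succ) (X.face β 0 c)
                = X.iterFace (fun k => G (ψ k).succ) d.2 := by
            rintro d rfl ψ hψ hr
            exact ih X (fun i => J i.succ) (fun i => G i.succ) (fun i => hG i.succ) _ ψ hψ hr
          rw [key2 _ e _ hm hr']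
          simp
      exact key _ (X.iterFace_free J c hJ).symm ψ hψ hr

/-- The iterated faces of an iterated face `d_J c` are the `d_G c` for the subfaces `G` of `J`. -/
theorem iterFace_comp {n : ℕ} {J G : CubeFace n} (hG : G.IsSubface J) (c : X.cube n) {d : X.Cell}
    (hd : X.iterFace J c = d) (ψ : Fin d.1 ≃o {j : Fin n // J j = none}) :
    X.iterFace G c = X.iterFace (fun k => G (ψ k)) d.2 := by
  subst hd
  refine X.iterFace_comp_aux J G hG c (fun k => (ψ k : Fin n)) (fun a b h => ψ.strictMono h) ?_
  intro j
  constructor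
  · rintro ⟨k, rfl⟩; exact (ψ k).2
  · intro h; exact ⟨ψ.symm ⟨j, h⟩, by simp⟩

theorem exists_orderIso {n : ℕ} {J : CubeFace n} {c : X.cube n} {d : X.Cell}
    (hd : X.iterFace J c = d) : Nonempty (Fin d.1 ≃o {j : Fin n // J j = none}) := by
  subst hd
  exact CubeFace.exists_orderIso_free (X.iterFace_fst J c)

/-- On the free coordinates of `J` the face `src J` is the bottom corner, so composition of iterated
faces gives the bottom vertex of `d_J c`. -/
theorem src_iterFace {n : ℕ} (J : CubeFace n) (c : X.cube n) :
    src (X.iterFace J c) = X.iterFace (src J) c := by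
  obtain ⟨ψ⟩ := X.exists_orderIso (rfl : X.iterFace J c = _)
  rw [X.iterFace_comp (CubeFace.src_isSubface J) c rfl ψ]
  have : (fun k => src J (ψ k : Fin n)) = CubeFace.corner _ false := by
    funext k
    rw [CubeFace.src_apply, (ψ k).2]; rfl
  rw [this, iterFace_corner]
  rfl

theorem tgt_iterFace {n : ℕ} (J : CubeFace n) (c : X.cube n) :
    tgt (X.iterFace J c) = X.iterFace (tgt J) c := by
  obtain ⟨ψ⟩ := X.exists_orderIso (rfl : X.iterFace J c = _)
  rw [X.iterFace_comp (CubeFace.tgt_isSubface J) c rfl ψ]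
  have : (fun k => tgt J (ψ k : Fin n)) = CubeFace.corner _ true := by
    funext k
    rw [CubeFace.tgt_apply, (ψ k).2]; rfl
  rw [this, iterFace_corner]
  rfl

theorem src_iterFace_eq_iff {n : ℕ} {J : CubeFace n} {c : X.cube n} :
    src (X.iterFace J c) = X.iterFace J c ↔ src J = J := by
  rw [src_eq_self_iff, iterFace_fst, Fintype.card_eq_zero_iff, CubeFace.src_eq_self_iff]
  exact ⟨fun h i hi => h.elim ⟨i, hi⟩, fun h => ⟨fun i => h i.1 i.2⟩⟩

theorem exists_orderIso_of_eq {m n : ℕ} {J : CubeFace m} {K : CubeFace n} {c : X.cube m}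
    {e : X.cube n} (h : X.iterFace J c = X.iterFace K e) :
    Nonempty ({j : Fin m // J j = none} ≃o {i : Fin n // K i = none}) := by
  obtain ⟨ψ⟩ := X.exists_orderIso h
  obtain ⟨ψ'⟩ := X.exists_orderIso (rfl : X.iterFace K e = _)
  exact ⟨ψ.symm.trans ψ'⟩

/-- Both sides are the same iterated face of the common cube `d_J c = d_K e`: the free coordinates
of `J` and of `K` are enumerated compatibly by `ψ` and `ψ.trans φ`. -/
theorem iterFace_transfer {m n : ℕ} {J : CubeFace m} {K : CubeFace n}
    (φ : {j : Fin m // J j = none} ≃o {i : Fin n // K i = none}) {c : X.cube m} {e : X.cube n}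
    (h : X.iterFace J c = X.iterFace K e) {G : CubeFace m} (hG : G.IsSubface J) :
    X.iterFace (CubeFace.transfer J K φ G) e = X.iterFace G c := by
  obtain ⟨ψ⟩ := X.exists_orderIso h
  rw [X.iterFace_comp hG c h ψ,
    X.iterFace_comp (J := K) (G := CubeFace.transfer J K φ G) _ e rfl (ψ.trans φ)]
  · congr 1
    funext k
    have : K (φ (ψ k)) = none := (φ (ψ k)).2
    simp [CubeFace.transfer, this]
  · intro i α hi
    simp [CubeFace.transfer, hi]

end PrecubicalSet

/-! ### Transfer of faces, and chains of faces in one cube -/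

namespace CubeFace

variable {m n : ℕ} {J : CubeFace m} {K : CubeFace n}
  (φ : {j : Fin m // J j = none} ≃o {i : Fin n // K i = none})

theorem src_transfer (G : CubeFace m) : src (transfer J K φ G) = transfer J K φ (src G) := by
  funext i
  rw [src_apply]
  unfold transfer
  split_ifs with h
  · rfl
  · cases hK : K i with
    | none => exact absurd hK h
    | some α => rfl

theorem tgt_transfer (G : CubeFace m) : tgt (transfer J K φ G) = transfer J K φ (tgt G) := by
  funext i
  rw [tgt_apply]
  unfold transfer
  split_ifs with h
  · rfl
  · cases hK : K i with
    | none => exact absurd hK h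
    | some α => rfl

theorem transfer_self : transfer J K φ J = K := by
  funext i
  unfold transfer
  split_ifs with h
  · rw [(φ.symm ⟨i, h⟩).2, h]
  · rfl

end CubeFace

namespace CubeFace

variable {n : ℕ}

/-- Along a chain of faces each coordinate moves only from `0` through free to `1`, so a coordinate
that has reached `1` stays there. -/
theorem chain_eq_true {u v : CubeFace n} {L : List (CubeFace n)} (h : Chain u L v) {i : Fin n}
    (hi : u i = some true) : v i = some true ∧ ∀ G ∈ L, G i = some true := by
  induction L generalizing u with
  | nil => rw [← chain_nil.mp h]; simpa using hi
  | cons G L ih =>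
    obtain ⟨-, rfl, h3⟩ := h
    have hG : G i = some true := by
      rw [src_apply] at hi
      cases hG : G i <;> simp_all
    have := ih h3 (by rw [tgt_apply, hG]; rfl)
    simpa [hG] using this

theorem chain_eq_false {u v : CubeFace n} {L : List (CubeFace n)} (h : Chain u L v) {i : Fin n}
    (hi : v i = some false) : u i = some false ∧ ∀ G ∈ L, G i = some false := by
  induction L generalizing u with
  | nil => rw [chain_nil.mp h]; simpa using hi
  | cons G L ih =>
    obtain ⟨-, rfl, h3⟩ := h
    have h4 := ih h3
    have hG : G i = some false := by
      have := h4.1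
      rw [tgt_apply] at this
      cases hG : G i <;> simp_all
    exact ⟨by rw [src_apply, hG]; rfl, by simpa [hG] using h4.2⟩

/-- A coordinate fixed by `K` has the same value at both ends, and coordinates are monotone along
the chain. -/
theorem isSubface_of_chain {K : CubeFace n} {L : List (CubeFace n)}
    (h : Chain (src K) L (tgt K)) {G : CubeFace n} (hG : G ∈ L) : G.IsSubface K := by
  rintro i (_ | _) hi
  · exact (chain_eq_false h (i := i) (by rw [tgt_apply, hi]; rfl)).2 G hG
  · exact (chain_eq_true h (i := i) (by rw [src_apply, hi]; rfl)).2 G hG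

/-- Passing a member `G` of the chain turns exactly its free coordinates from `0` to `1`, so the
left side counts the coordinates used up and those still at `0`. -/
theorem sum_free_add {u v : CubeFace n} {L : List (CubeFace n)} (h : Chain u L v) :
    (L.map fun G => Fintype.card {j : Fin n // G j = none}).sum
      + Fintype.card {j : Fin n // v j = some false}
      = Fintype.card {j : Fin n // u j = some false} := by
  induction L generalizing u with
  | nil => rw [chain_nil.mp h]; simp
  | cons G L ih =>
    obtain ⟨-, rfl, h3⟩ := h
    have h1 := ih h3
    rw [List.map_cons, List.sum_cons, add_assoc, h1]
    simp only [Fintype.card_subtype, Finset.card_filter, ← Finset.sum_add_distrib]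
    refine Finset.sum_congr rfl fun i _ => ?_
    rw [src_apply, tgt_apply]
    rcases hG : G i with _ | _ | _ <;> simp

end CubeFace

/-! ### Refinement of cubes, lists and chains -/

namespace PrecubicalSet

variable {X : PrecubicalSet.{u}}

/-- The list `l` is a refinement of the cube `e`: it is the image of a chain of faces of `I^n` from
the bottom vertex to the top vertex. -/
def RefinesCell (e : X.Cell) (l : List X.Cell) : Prop :=
  ∃ L : List (CubeFace e.1), Chain (CubeFace.corner e.1 false) L (CubeFace.corner e.1 true) ∧
    L.map (fun G => X.iterFace G e.2) = l

theorem chain_map_iterFace {n : ℕ} (e : X.cube n) {u v : CubeFace n} {L : List (CubeFace n)}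
    (h : Chain u L v) :
    Chain (X.iterFace u e) (L.map fun G => X.iterFace G e) (X.iterFace v e) :=
  h.map _ (fun G _ => (X.src_iterFace G e).symm) (fun G _ => (X.tgt_iterFace G e).symm)
    (fun _ _ hG => X.src_iterFace_eq_iff.not.mpr hG)

theorem RefinesCell.chain {e : X.Cell} {l : List X.Cell} (h : RefinesCell e l) :
    Chain (src e) l (tgt e) := by
  obtain ⟨L, hL, rfl⟩ := h
  have := chain_map_iterFace e.2 hL
  rwa [iterFace_corner, iterFace_corner] at this

theorem RefinesCell.sum_dim {e : X.Cell} {l : List X.Cell} (h : RefinesCell e l) :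
    (l.map Sigma.fst).sum = e.1 := by
  obtain ⟨L, hL, rfl⟩ := h
  have := CubeFace.sum_free_add hL
  simp only [List.map_map, Function.comp_def, iterFace_fst]
  simpa [CubeFace.corner] using this

theorem RefinesCell.refl {e : X.Cell} (he : 0 < e.1) : RefinesCell e [e] := by
  refine ⟨[fun _ => none], ⟨?_, rfl, rfl⟩, ?_⟩
  · rw [Ne, CubeFace.src_eq_self_iff]
    exact fun h => h ⟨0, he⟩ rfl
  · simp [iterFace_none]

theorem refinesCell_nil_iff {e : X.Cell} : RefinesCell e [] ↔ e.1 = 0 := by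
  constructor
  · intro h
    simpa using h.sum_dim.symm
  · intro h
    refine ⟨[], ?_, rfl⟩
    funext i
    rw [h] at i
    exact i.elim0

/-- A single face whose source is the bottom corner and whose target is the top corner has every
coordinate free. -/
theorem RefinesCell.eq_of_singleton {e f : X.Cell} (h : RefinesCell e [f]) : f = e := by
  obtain ⟨L, hL, hl⟩ := h
  obtain ⟨G, rfl, rfl⟩ : ∃ G, L = [G] ∧ X.iterFace G e.2 = f := by
    obtain ⟨G, L', rfl, h1, h2⟩ := List.map_eq_cons_iff.mp hl
    exact ⟨G, by rw [List.map_eq_nil_iff.mp h2], h1⟩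
  have hG : G = fun _ => none := by
    funext i
    have h1 := congrFun hL.2.1 i
    have h2 := congrFun (chain_nil.mp hL.2.2) i
    rw [CubeFace.src_apply] at h1
    rw [CubeFace.tgt_apply] at h2
    rcases hG : G i with _ | _ | _ <;> simp_all [CubeFace.corner]
  rw [hG, iterFace_none]

/-- Refinements of an iterated face are chains of faces of the given cube. -/
theorem refinesCell_iterFace_iff {n : ℕ} (K : CubeFace n) (e : X.cube n) (l : List X.Cell) :
    RefinesCell (X.iterFace K e) l ↔
      ∃ L : List (CubeFace n), Chain (src K) L (tgt K) ∧ L.map (fun G => X.iterFace G e) = l := by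
  set d := X.iterFace K e with hd
  have hde : X.iterFace (fun _ => none) d.2 = X.iterFace K e := by rw [iterFace_none]
  obtain ⟨φ⟩ := X.exists_orderIso_of_eq hde
  constructor
  · rintro ⟨L, hL, rfl⟩
    have hsub (G : CubeFace d.1) : G.IsSubface fun _ => none := fun i α h => nomatch h
    refine ⟨L.map (CubeFace.transfer _ K φ), ?_, ?_⟩
    · have := hL.map (CubeFace.transfer _ K φ) (fun G _ => (CubeFace.src_transfer φ G).symm)
        (fun G _ => (CubeFace.tgt_transfer φ G).symm) (fun G _ hG => by
          refine (X.src_iterFace_eq_iff (c := e)).not.mp ?_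
          rw [X.iterFace_transfer φ hde (hsub G)]
          exact X.src_iterFace_eq_iff.not.mpr hG)
      have e1 : CubeFace.corner d.1 false = src (fun _ => none : CubeFace d.1) := rfl
      have e2 : CubeFace.corner d.1 true = tgt (fun _ => none : CubeFace d.1) := rfl
      rwa [e1, e2, ← CubeFace.src_transfer, ← CubeFace.tgt_transfer, CubeFace.transfer_self] at this
    · rw [List.map_map]
      exact List.map_congr_left fun G _ => X.iterFace_transfer φ hde (hsub G)
  · rintro ⟨L, hL, rfl⟩
    -- Transfer out of `K` preserves iterated faces only for subfaces of `K`; the ends of the chain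
    -- force its members to be such.
    have hsub : ∀ G ∈ L, G.IsSubface K := fun G hG => CubeFace.isSubface_of_chain hL hG
    refine ⟨L.map (CubeFace.transfer K _ φ.symm), ?_, ?_⟩
    · have := hL.map (CubeFace.transfer K _ φ.symm)
        (fun G _ => (CubeFace.src_transfer φ.symm G).symm)
        (fun G _ => (CubeFace.tgt_transfer φ.symm G).symm) (fun G hm hG => by
          refine (X.src_iterFace_eq_iff (c := d.2)).not.mp ?_
          rw [X.iterFace_transfer φ.symm hde.symm (hsub G hm)]
          exact X.src_iterFace_eq_iff.not.mpr hG)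
      rwa [← CubeFace.src_transfer, ← CubeFace.tgt_transfer, CubeFace.transfer_self] at this
    · rw [List.map_map]
      exact List.map_congr_left fun G hm => X.iterFace_transfer φ.symm hde.symm (hsub G hm)

/-- A refinement of `e` is cut into two pieces exactly by the elementary refinements of `e`. -/
theorem refinesCell_append_iff {e : X.Cell} {l l' : List X.Cell} :
    RefinesCell e (l ++ l') ↔ ∃ J : Set (Fin e.1), RefinesCell (X.splitFirst J e.2) l ∧
      RefinesCell (X.splitSecond J e.2) l' := by
  classical
  have hends (J : Set (Fin e.1)) :
      src (fun i => if i ∈ J then some false else none : CubeFace e.1)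
        = CubeFace.corner e.1 false ∧
      tgt (fun i => if i ∈ J then none else some true : CubeFace e.1)
        = CubeFace.corner e.1 true ∧
      tgt (fun i => if i ∈ J then some false else none : CubeFace e.1)
        = (fun i => if i ∈ J then some false else some true) ∧
      src (fun i => if i ∈ J then none else some true : CubeFace e.1)
        = (fun i => if i ∈ J then some false else some true) := by
    refine ⟨?_, ?_, ?_, ?_⟩ <;> funext i <;> by_cases h : i ∈ J <;>
      simp [CubeFace.src_apply, CubeFace.tgt_apply, CubeFace.corner, h]
  constructor
  · rintro ⟨L, hL, hl⟩
    obtain ⟨L1, L2, rfl, rfl, rfl⟩ := List.map_eq_append_iff.mp hl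
    obtain ⟨m, h1, h2⟩ := chain_append.mp hL
    have hm : src m = m := h1.src_right rfl
    -- The two parts of the chain meet at the vertex `m`; the splitting set consists of the
    -- coordinates not yet traversed, those equal to `0` at `m`.
    obtain ⟨J, hJ⟩ : ∃ J : Set (Fin e.1), ∀ i, i ∈ J ↔ m i = some false :=
      ⟨{i | m i = some false}, fun _ => Iff.rfl⟩
    have hm' : m = fun i => if i ∈ J then some false else some true := by
      funext i
      have := CubeFace.src_eq_self_iff.mp hm i
      simp only [hJ]
      rcases h : m i with _ | _ | _ <;> simp_all
    refine ⟨J, ?_, ?_⟩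
    · rw [splitFirst, refinesCell_iterFace_iff]
      refine ⟨L1, ?_, rfl⟩
      rwa [(hends _).1, (hends _).2.2.1, ← hm']
    · rw [splitSecond, refinesCell_iterFace_iff]
      refine ⟨L2, ?_, rfl⟩
      rwa [(hends _).2.1, (hends _).2.2.2, ← hm']
  · rintro ⟨J, h1, h2⟩
    rw [splitFirst, refinesCell_iterFace_iff] at h1
    rw [splitSecond, refinesCell_iterFace_iff] at h2
    obtain ⟨L1, h1, rfl⟩ := h1
    obtain ⟨L2, h2, rfl⟩ := h2
    rw [(hends _).1, (hends _).2.2.1] at h1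
    rw [(hends _).2.1, (hends _).2.2.2] at h2
    exact ⟨L1 ++ L2, chain_append.mpr ⟨_, h1, h2⟩, List.map_append⟩

theorem dim_splitFirst_pos {n : ℕ} {J : Set (Fin n)} (e : X.cube n) :
    0 < (X.splitFirst J e).1 ↔ J ≠ univ := by
  rw [splitFirst, iterFace_fst, Fintype.card_pos_iff, Ne, eq_univ_iff_forall, not_forall]
  constructor
  · rintro ⟨i, hi⟩; exact ⟨i, fun h => by simp [h] at hi⟩
  · rintro ⟨i, hi⟩; exact ⟨i, by simp [hi]⟩

theorem dim_splitSecond_pos {n : ℕ} {J : Set (Fin n)} (e : X.cube n) :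
    0 < (X.splitSecond J e).1 ↔ J ≠ ∅ := by
  rw [splitSecond, iterFace_fst, Fintype.card_pos_iff, ← nonempty_iff_ne_empty]
  constructor
  · rintro ⟨i, hi⟩; exact ⟨i, by by_contra h; simp [h] at hi⟩
  · rintro ⟨i, hi⟩; exact ⟨i, by simp [hi]⟩

/-- Refinement of lists of cubes, piece by piece. -/
def RefinesList : List X.Cell → List X.Cell → Prop
  | [], l => l = []
  | e :: es, l => ∃ l₁ l₂, l = l₁ ++ l₂ ∧ RefinesCell e l₁ ∧ RefinesList es l₂

theorem refinesList_nil {l : List X.Cell} : RefinesList [] l ↔ l = [] := Iff.rfl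

theorem refinesList_cons {e : X.Cell} {es l : List X.Cell} :
    RefinesList (e :: es) l ↔
      ∃ l₁ l₂, l = l₁ ++ l₂ ∧ RefinesCell e l₁ ∧ RefinesList es l₂ := Iff.rfl

theorem refinesList_append {es es' l : List X.Cell} :
    RefinesList (es ++ es') l ↔ ∃ l₁ l₂, l = l₁ ++ l₂ ∧ RefinesList es l₁ ∧ RefinesList es' l₂ := by
  induction es generalizing l with
  | nil => simp [refinesList_nil]
  | cons e es ih =>
    simp only [List.cons_append, refinesList_cons, ih]
    constructor
    · rintro ⟨l1, _, rfl, h, l2, l3, rfl, h2, h3⟩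
      exact ⟨l1 ++ l2, l3, by simp, ⟨l1, l2, rfl, h, h2⟩, h3⟩
    · rintro ⟨_, l3, rfl, ⟨l1, l2, rfl, h, h2⟩, h3⟩
      exact ⟨l1, l2 ++ l3, by simp, h, l2, l3, rfl, h2, h3⟩

theorem refinesList_singleton {e : X.Cell} {l : List X.Cell} :
    RefinesList [e] l ↔ RefinesCell e l := by
  simp [refinesList_cons, refinesList_nil]

theorem RefinesList.refl {l : List X.Cell} (h : ∀ e ∈ l, 0 < e.1) : RefinesList l l := by
  induction l with
  | nil => rfl
  | cons e es ih =>
    exact ⟨[e], es, rfl, RefinesCell.refl (h e (by simp)), ih fun c hc => h c (by simp [hc])⟩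

theorem refinesList_pair {e : X.Cell} {l : List X.Cell} {J : Set (Fin e.1)}
    (h : RefinesList [X.splitFirst J e.2, X.splitSecond J e.2] l) : RefinesCell e l := by
  obtain ⟨l₁, l₂, rfl, h1, h2⟩ := h
  exact refinesCell_append_iff.mpr ⟨J, h1, refinesList_singleton.mp h2⟩

/-- Elementary refinement of lists. -/
def ElemRefinesList (l l' : List X.Cell) : Prop :=
  ∃ (L R : List X.Cell) (n : ℕ) (e : X.cube n) (J : Set (Fin n)),
    J ≠ ∅ ∧ J ≠ univ ∧ l = L ++ ⟨n, e⟩ :: R ∧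
      l' = L ++ X.splitFirst J e :: X.splitSecond J e :: R

theorem ElemRefinesList.append {l l' : List X.Cell} (h : ElemRefinesList l l')
    (A B : List X.Cell) : ElemRefinesList (A ++ l ++ B) (A ++ l' ++ B) := by
  obtain ⟨L, R, n, e, J, h1, h2, rfl, rfl⟩ := h
  exact ⟨A ++ L, R ++ B, n, e, J, h1, h2, by simp, by simp⟩

theorem reflTransGen_append {l l' : List X.Cell}
    (h : Relation.ReflTransGen ElemRefinesList l l') (A B : List X.Cell) :
    Relation.ReflTransGen ElemRefinesList (A ++ l ++ B) (A ++ l' ++ B) :=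
  h.lift (fun m => A ++ m ++ B) fun _ _ h => h.append A B

/-- The members are peeled off one by one: cutting `g :: l` after `g` gives an elementary refinement
of `e` whose first piece is `g` itself, and `l` refines the second piece. -/
theorem RefinesCell.reflTransGen {e : X.Cell} {l : List X.Cell} (he : 0 < e.1)
    (h : RefinesCell e l) : Relation.ReflTransGen ElemRefinesList [e] l := by
  induction l generalizing e with
  | nil => exact absurd (refinesCell_nil_iff.mp h) he.ne'
  | cons g l ih =>
    by_cases hl : l = []
    · subst hl
      rw [h.eq_of_singleton]
    · obtain ⟨J, h1, h2⟩ := (refinesCell_append_iff (l := [g])).mp h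
      have hJ : J ≠ ∅ := by
        -- Dimensions add up under refinement, so a second piece of dimension zero could not be
        -- refined by the nonempty list `l` of cubes of positive dimension.
        rw [← dim_splitSecond_pos e.2, Nat.pos_iff_ne_zero]
        intro h0
        have hsum := h2.sum_dim
        rw [h0] at hsum
        obtain ⟨c, hc⟩ := List.exists_mem_of_ne_nil l hl
        have h3 := src_ne_self_iff.mp (h2.chain.src_ne hc)
        have h4 := List.single_le_sum (l := l.map Sigma.fst) (by simp) c.1
          (List.mem_map_of_mem hc)
        omega
      have hJ' : J ≠ univ := by
        rw [← dim_splitFirst_pos e.2, ← h1.eq_of_singleton]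
        exact src_ne_self_iff.mp (h1.chain.src_ne (by simp))
      have step : ElemRefinesList [e] [g, X.splitSecond J e.2] :=
        ⟨[], [], e.1, e.2, J, hJ, hJ', rfl, by rw [h1.eq_of_singleton]; rfl⟩
      refine Relation.ReflTransGen.head step ?_
      have := reflTransGen_append (ih ((dim_splitSecond_pos e.2).mpr hJ) h2) [g] []
      simpa using this

theorem RefinesList.reflTransGen {es l : List X.Cell} (hes : ∀ e ∈ es, 0 < e.1)
    (h : RefinesList es l) : Relation.ReflTransGen ElemRefinesList es l := by
  induction es generalizing l with
  | nil => rw [refinesList_nil.mp h]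
  | cons e es ih =>
    obtain ⟨l₁, l₂, rfl, h1, h2⟩ := h
    have s1 := reflTransGen_append (h1.reflTransGen (hes e (by simp))) [] es
    have s2 := reflTransGen_append (ih (fun c hc => hes c (by simp [hc])) h2) l₁ []
    simp only [List.nil_append, List.append_nil] at s1 s2
    exact s1.trans s2

theorem chain_iff_linked {a b : X.cube 0} {l : List X.Cell} :
    Chain (⟨0, a⟩ : X.Cell) l ⟨0, b⟩ ↔ X.Linked a l b ∧ ∀ c ∈ l, 0 < c.1 := by
  induction l generalizing a with
  | nil => simp [chain_nil, Linked]
  | cons c cs ih =>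
    rw [chain_cons, src_ne_self_iff]
    have : tgt c = ⟨0, X.endVertex true c.2⟩ := rfl
    rw [this, ih]
    have : src c = ⟨0, a⟩ ↔ X.endVertex false c.2 = a := by
      change (⟨0, X.endVertex false c.2⟩ : X.Cell) = ⟨0, a⟩ ↔ _
      simp
    rw [this, Linked]
    simp only [List.forall_mem_cons]
    tauto

namespace CubeChain

variable {x y : X.cube 0}

theorem chain (c : X.CubeChain x y) : Chain (⟨0, x⟩ : X.Cell) c.cubes ⟨0, y⟩ :=
  chain_iff_linked.mpr ⟨c.linked, c.dim_pos⟩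

theorem exists_of_chain {l : List X.Cell} (h : Chain (⟨0, x⟩ : X.Cell) l ⟨0, y⟩) :
    ∃ c : X.CubeChain x y, c.cubes = l :=
  ⟨⟨l, (chain_iff_linked.mp h).2, (chain_iff_linked.mp h).1⟩, rfl⟩

/-- Since `J` is neither empty nor everything, both pieces have positive dimension, and they form a
chain with the ends of the replaced cube. -/
theorem exists_of_elemRefinesList (c : X.CubeChain x y) {l : List X.Cell}
    (h : ElemRefinesList c.cubes l) :
    ∃ d : X.CubeChain x y, d.cubes = l ∧ d.ElementaryRefines c := by
  have hc := c.chain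
  obtain ⟨L, R, n, e, J, h1, h2, h3, rfl⟩ := h
  have hl : Chain (⟨0, x⟩ : X.Cell) (L ++ X.splitFirst J e :: X.splitSecond J e :: R) ⟨0, y⟩ := by
    rw [h3, chain_append] at hc
    obtain ⟨m, hL, -, rfl, hR⟩ := hc
    refine chain_append.mpr ⟨_, hL, ?_⟩
    have hp : RefinesCell ⟨n, e⟩ [X.splitFirst J e, X.splitSecond J e] :=
      refinesCell_append_iff (l := [_]).mpr ⟨J,
        RefinesCell.refl ((dim_splitFirst_pos e).mpr h2),
        RefinesCell.refl ((dim_splitSecond_pos e).mpr h1)⟩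
    exact (chain_append (l := [_, _])).mpr ⟨_, hp.chain, hR⟩
  obtain ⟨d, hd⟩ := exists_of_chain hl
  exact ⟨d, hd, L, R, n, e, J, h1, h2, h3, hd⟩

/-- Refinement of chains is refinement piece by piece. -/
theorem refines_iff {c d : X.CubeChain x y} : d.Refines c ↔ RefinesList c.cubes d.cubes := by
  constructor
  · intro h
    induction h using Relation.ReflTransGen.head_induction_on with
    | refl => exact RefinesList.refl d.dim_pos
    | head h1 _ ih =>
      obtain ⟨L, R, n, e, J, -, -, h3, h4⟩ := h1
      rw [h4, refinesList_append] at ih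
      obtain ⟨l₁, l₂, h, hL, hR⟩ := ih
      obtain ⟨l₃, l₄, rfl, h5, h6⟩ :=
        (refinesList_append (es := [X.splitFirst J e, X.splitSecond J e])).mp hR
      rw [h, h3, refinesList_append]
      exact ⟨l₁, _, rfl, hL, l₃, l₄, rfl, refinesList_pair (e := ⟨n, e⟩) h5, h6⟩
  · intro h
    -- A sequence of elementary refinements of lists starting at a chain stays among chains.
    have key : ∀ l, Relation.ReflTransGen ElemRefinesList c.cubes l →
        ∃ d : X.CubeChain x y, d.cubes = l ∧ d.Refines c := by
      intro l hl
      induction hl with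
      | refl => exact ⟨c, rfl, Relation.ReflTransGen.refl⟩
      | tail _ h2 ih =>
        obtain ⟨d, rfl, hd⟩ := ih
        obtain ⟨d', hd', h3⟩ := d.exists_of_elemRefinesList h2
        exact ⟨d', hd', hd.tail h3⟩
    obtain ⟨d', h1, h2⟩ := key _ (h.reflTransGen c.dim_pos)
    rwa [CubeChain.ext h1] at h2

/-- Each elementary refinement adds one cube, so length strictly increases under proper refinement;
antisymmetry follows. -/
theorem Refines.length_le {c d : X.CubeChain x y} (h : d.Refines c) :
    d = c ∨ c.cubes.length < d.cubes.length := by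
  induction h with
  | refl => exact Or.inl rfl
  | tail _ h2 ih =>
    obtain ⟨L, R, n, e, J, -, -, h3, h4⟩ := h2
    right
    rcases ih with rfl | ih
    · simp [h3, h4]
    · refine ih.trans ?_
      simp [h3, h4]

theorem Refines.antisymm {c d : X.CubeChain x y} (h : d.Refines c) (h' : c.Refines d) : d = c := by
  rcases h.length_le with h1 | h1
  · exact h1
  · rcases h'.length_le with h2 | h2
    · exact h2.symm
    · omega

end CubeChain

/-! Coarsest common refinements in proper `□`-sets -/

theorem IsProper.cell_eq (hX : X.IsProper) {c d : X.Cell} (hs : src c = src d)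
    (ht : tgt c = tgt d) : c = d := by
  refine hX c d ?_ ?_
  · have h : (⟨0, X.endVertex false c.2⟩ : X.Cell) = ⟨0, X.endVertex false d.2⟩ := hs
    simpa using h
  · have h : (⟨0, X.endVertex true c.2⟩ : X.Cell) = ⟨0, X.endVertex true d.2⟩ := ht
    simpa using h

theorem RefinesCell.dim_pos {e : X.Cell} {l : List X.Cell} (h : RefinesCell e l) :
    ∀ c ∈ l, 0 < c.1 := fun _ hc => src_ne_self_iff.mp (h.chain.src_ne hc)

theorem eq_nil_of_sum_eq {D M : List X.Cell} (hM : ∀ c ∈ M, 0 < c.1)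
    (h : ((D ++ M).map Sigma.fst).sum ≤ (D.map Sigma.fst).sum) : M = [] := by
  rw [List.map_append, List.sum_append] at h
  cases M with
  | nil => rfl
  | cons c M =>
    have := hM c (by simp)
    simp at h
    omega

/-- If the list `d` refines the lists `e :: es` and `e' :: es'` and `e` is not longer than `e'`,
then the part of `d` refining `e'` begins with the part refining `e`. -/
theorem exists_common_split {e e' : X.Cell} {es es' d : List X.Cell} (h : RefinesList (e :: es) d)
    (h' : RefinesList (e' :: es') d) (hle : e.1 ≤ e'.1) :
    ∃ D M d', d = D ++ (M ++ d') ∧ RefinesCell e D ∧ RefinesCell e' (D ++ M) ∧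
      RefinesList es (M ++ d') ∧ RefinesList es' d' := by
  obtain ⟨D, ds, rfl, hD, hds⟩ := h
  obtain ⟨D', ds', heq, hD', hds'⟩ := h'
  -- One of `D`, `D'` is an initial segment of the other. If it is `D'`, then `hle` leaves no
  -- dimension for the surplus `M`, which is therefore empty.
  rcases List.append_eq_append_iff.mp heq with ⟨M, rfl, rfl⟩ | ⟨M, rfl, rfl⟩
  · exact ⟨D, M, ds', rfl, hD, hD', hds, hds'⟩
  · obtain rfl : M = [] := by
      refine eq_nil_of_sum_eq (D := D') (fun c hc => hD.dim_pos c (by simp [hc])) ?_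
      rw [hD.sum_dim, hD'.sum_dim]
      exact hle
    exact ⟨D', [], ds, by simp, by simpa using hD, by simpa using hD', by simpa using hds,
      by simpa using hds'⟩

/-- The lists `c` and `c'` have a coarsest common refinement. -/
def HasCoarsest (c c' : List X.Cell) : Prop :=
  ∃ E, RefinesList c E ∧ RefinesList c' E ∧
    ∀ d, RefinesList c d → RefinesList c' d → RefinesList E d

theorem HasCoarsest.symm {c c' : List X.Cell} (h : HasCoarsest c c') : HasCoarsest c' c := by
  obtain ⟨E, h1, h2, h3⟩ := h
  exact ⟨E, h2, h1, fun d hd hd' => h3 d hd' hd⟩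

/-- A common refinement `D ++ (M ++ d')`, with `D` refining `e` and `D ++ M` refining `e'`, cuts
`e'` into pieces refined by `D` and `M`. The first piece has the ends of `e`, so it is `e` by
properness; the second, `s`, runs from `tgt e` to `tgt e'`, so it does not depend on the common
refinement. Thus `e` followed by a coarsest common refinement of `es` and `s :: es'` is coarsest for
the given lists. If `s` is a vertex, then `e = e'` and `es'` takes the place of `s :: es'`; the
length bound in `ih` admits both cases. -/
theorem IsProper.hasCoarsest_cons (hX : X.IsProper) {e e' : X.Cell} {es es' d : List X.Cell}
    {u v : X.Cell} (hc : Chain u (e :: es) v) (hc' : Chain u (e' :: es') v)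
    (hd : RefinesList (e :: es) d) (hd' : RefinesList (e' :: es') d) (hle : e.1 ≤ e'.1)
    (ih : ∀ es₂ : List X.Cell, es₂.length ≤ es'.length + 1 → Chain (tgt e) es₂ v →
      (∃ d, RefinesList es d ∧ RefinesList es₂ d) → HasCoarsest es es₂) :
    HasCoarsest (e :: es) (e' :: es') := by
  obtain ⟨hpos, hu, hes⟩ := hc
  obtain ⟨hpos', hu', hes'⟩ := hc'
  have hsrc : src e = src e' := hu.trans hu'.symm
  have heD : RefinesCell e [e] := RefinesCell.refl (src_ne_self_iff.mp hpos)
  -- every common refinement cuts `e'` into `e` and the same second piece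
  have hcut : ∀ d, RefinesList (e :: es) d → RefinesList (e' :: es') d → ∃ D M d',
      d = D ++ (M ++ d') ∧ RefinesCell e D ∧ RefinesList es (M ++ d') ∧ RefinesList es' d' ∧
      ∃ J : Set (Fin e'.1), X.splitFirst J e'.2 = e ∧ RefinesCell (X.splitSecond J e'.2) M ∧
        src (X.splitSecond J e'.2) = tgt e ∧ tgt (X.splitSecond J e'.2) = tgt e' := by
    intro d h h'
    obtain ⟨D, M, d', rfl, h1, h2, h3, h4⟩ := exists_common_split h h' hle
    obtain ⟨J, h5, h6⟩ := refinesCell_append_iff.mp h2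
    refine ⟨D, M, d', rfl, h1, h3, h4, J, ?_⟩
    obtain ⟨m, h7, h8⟩ := chain_append.mp h2.chain
    have hDne : D ≠ [] := by
      rintro rfl
      exact (src_ne_self_iff.mp hpos).ne' (refinesCell_nil_iff.mp h1)
    have h9 : m = tgt e := by
      have := h1.chain
      rw [hsrc] at this
      exact h7.unique_right this
    have h10 := h5.chain
    -- The nonempty list `D` determines its starting vertex, and hence its end. So the first piece
    -- of `e'` and the cube `e`, both refined by `D`, have the same ends.
    rw [← h10.unique_left h7 hDne] at h7
    have h11 := h7.unique_right h10
    have hJ : src (X.splitSecond J e'.2) = tgt (X.splitFirst J e'.2) ∧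
        tgt (X.splitSecond J e'.2) = tgt e' := by
      constructor
      · rw [splitFirst, splitSecond, src_iterFace, tgt_iterFace]
        congr 1
        funext i
        by_cases hi : i ∈ J <;> simp [CubeFace.src_apply, CubeFace.tgt_apply, hi]
      · rw [splitSecond, tgt_iterFace]
        have : tgt e' = X.iterFace (CubeFace.corner e'.1 true) e'.2 := by
          rw [iterFace_corner]; rfl
        rw [this]
        congr 1
        funext i
        by_cases hi : i ∈ J <;> simp [CubeFace.tgt_apply, CubeFace.corner, hi]
    refine ⟨hX.cell_eq ?_ ?_, h6, ?_, hJ.2⟩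
    · exact (h10.unique_left h1.chain hDne)
    · rw [← h11, h9]
    · rw [hJ.1, ← h11, h9]
  obtain ⟨D, M, d', rfl, h1, h2, h3, J, hJ, hM, hs, ht⟩ := hcut d hd hd'
  set s := X.splitSecond J e'.2 with hsdef
  -- a second piece of dimension zero is dropped
  by_cases hs0 : s.1 = 0
  · have hsv : src s = s := src_eq_self_iff.mpr hs0
    have hte : tgt e = tgt e' := by rw [← hs, ← ht, hsv, tgt_of_src s hsv]
    have hee : e = e' := hX.cell_eq hsrc hte
    subst hee
    have hdrop : ∀ d, RefinesList (e :: es) d → RefinesList (e :: es') d → ∃ D ds,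
        d = D ++ ds ∧ RefinesCell e D ∧ RefinesList es ds ∧ RefinesList es' ds := by
      intro d h h'
      obtain ⟨D, M, d', rfl, h1, h2, h3, h4⟩ := exists_common_split h h' le_rfl
      obtain rfl : M = [] := by
        refine eq_nil_of_sum_eq (D := D) (fun c hc => h2.dim_pos c (by simp [hc])) ?_
        rw [h1.sum_dim, h2.sum_dim]
      exact ⟨D, d', rfl, h1, by simpa using h3, h4⟩
    obtain ⟨D, ds, -, -, h4, h5⟩ := hdrop _ hd hd'
    obtain ⟨E, hE1, hE2, hE3⟩ := ih es' (by omega) hes' ⟨ds, h4, h5⟩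
    refine ⟨e :: E, ⟨[e], E, rfl, heD, hE1⟩, ⟨[e], E, rfl, heD, hE2⟩, fun d h h' => ?_⟩
    obtain ⟨D, ds, rfl, h6, h7, h8⟩ := hdrop d h h'
    exact ⟨D, ds, rfl, h6, hE3 _ h7 h8⟩
  · have hsne : src s ≠ s := src_ne_self_iff.mpr (Nat.pos_of_ne_zero hs0)
    have hchain : Chain (tgt e) (s :: es') v := ⟨hsne, hs, by rw [ht]; exact hes'⟩
    obtain ⟨E, hE1, hE2, hE3⟩ := ih (s :: es') (by simp) hchain
      ⟨M ++ d', h2, M, d', rfl, hM, h3⟩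
    refine ⟨e :: E, ⟨[e], E, rfl, heD, hE1⟩, ?_, fun d h h' => ?_⟩
    · obtain ⟨E1, E2, rfl, h4, h5⟩ := hE2
      refine ⟨[e] ++ E1, E2, by simp, refinesCell_append_iff.mpr ⟨J, ?_, h4⟩, h5⟩
      rwa [hJ]
    · obtain ⟨D', M', d'', rfl, h4, h5, h6, J', -, h8, h9, h10⟩ := hcut d h h'
      have : X.splitSecond J' e'.2 = s :=
        hX.cell_eq (h9.trans hs.symm) (h10.trans ht.symm)
      rw [this] at h8
      exact ⟨D', _, rfl, h4, hE3 _ h5 ⟨M', d'', rfl, h8, h6⟩⟩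

/-- Induction on the total length, removing the first cube of smaller dimension. An empty list has
only the empty refinement, so it shares none with a nonempty chain. -/
theorem IsProper.hasCoarsest (hX : X.IsProper) {u v : X.Cell} {c c' : List X.Cell}
    (hc : Chain u c v) (hc' : Chain u c' v) (h : ∃ d, RefinesList c d ∧ RefinesList c' d) :
    HasCoarsest c c' := by
  induction hn : c.length + c'.length using Nat.strong_induction_on generalizing u c c' with
  | _ N ih =>
  subst hn
  obtain ⟨d, hd, hd'⟩ := h
  have hnil : ∀ (e : X.Cell) (es : List X.Cell), src e ≠ e → RefinesList (e :: es) d → d ≠ [] := by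
    rintro e es he ⟨l₁, l₂, rfl, h1, -⟩ h0
    obtain ⟨rfl, -⟩ := List.append_eq_nil_iff.mp h0
    exact (src_ne_self_iff.mp he).ne' (refinesCell_nil_iff.mp h1)
  cases c with
  | nil =>
    cases c' with
    | nil => exact ⟨[], rfl, rfl, fun d h _ => h⟩
    | cons e' es' => exact absurd (refinesList_nil.mp hd) (hnil e' es' hc'.1 hd')
  | cons e es =>
    cases c' with
    | nil => exact absurd (refinesList_nil.mp hd') (hnil e es hc.1 hd)
    | cons e' es' =>
      rcases le_total e.1 e'.1 with hle | hle
      · refine hX.hasCoarsest_cons hc hc' hd hd' hle fun es₂ hlen h2 h3 => ?_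
        exact ih _ (by simp; omega) hc.2.2 h2 h3 rfl
      · refine (hX.hasCoarsest_cons hc' hc hd' hd hle fun es₂ hlen h2 h3 => ?_).symm
        exact ih _ (by simp; omega) hc'.2.2 h2 h3 rfl

theorem IsProper.exists_isCoarsestCommonRefinement (hX : X.IsProper) {x y : X.cube 0}
    {c c' d : X.CubeChain x y} (hd : d.IsCommonRefinement c c') :
    ∃ E : X.CubeChain x y, E.IsCoarsestCommonRefinement c c' := by
  obtain ⟨E, h1, h2, h3⟩ := hX.hasCoarsest c.chain c'.chain
    ⟨d.cubes, CubeChain.refines_iff.mp hd.1, CubeChain.refines_iff.mp hd.2⟩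
  -- Refinement preserves the ends, so the list `E` is the list of cubes of a chain.
  have hE : ∀ {l l' : List X.Cell} {u v : X.Cell}, Chain u l v → RefinesList l l' →
      Chain u l' v := by
    intro l
    induction l with
    | nil => rintro l' u v h rfl; exact h
    | cons e es ih =>
      rintro l' u v ⟨-, rfl, h⟩ ⟨l₁, l₂, rfl, h1, h2⟩
      exact chain_append.mpr ⟨_, h1.chain, ih h h2⟩
  obtain ⟨E, rfl⟩ := CubeChain.exists_of_chain (hE c.chain h1)
  refine ⟨E, ⟨CubeChain.refines_iff.mpr h1, CubeChain.refines_iff.mpr h2⟩, fun f hf => ?_⟩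
  exact CubeChain.refines_iff.mpr
    (h3 _ (CubeChain.refines_iff.mp hf.1) (CubeChain.refines_iff.mp hf.2))

end PrecubicalSet

/-! ### Step functions on intervals -/

/-- A transitive relation that holds locally to the right and to the left of each point of an
interval holds for its end points. -/
theorem unitInterval.rel_of_local (R : I → I → Prop) (hrefl : ∀ a, R a a)
    (htrans : ∀ a b c, a ≤ b → b ≤ c → R a b → R b c → R a c) {a b : I} (hab : a ≤ b)
    (hr : ∀ s, a ≤ s → s < b → ∀ᶠ t in 𝓝[>] s, R s t)
    (hl : ∀ s, a < s → s ≤ b → ∀ᶠ t in 𝓝[<] s, R t s) : R a b := by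
  -- Let `c` be the supremum of the points related to `a`. The hypothesis on the left of `c` shows
  -- that `c` is related to `a`, and the one on the right would lead beyond `c` if `c < b`.
  set S : Set I := {t | a ≤ t ∧ t ≤ b ∧ R a t} with hS
  have haS : a ∈ S := ⟨le_rfl, hab, hrefl a⟩
  have hlub : IsLUB S (sSup S) := isLUB_csSup ⟨a, haS⟩ ⟨b, fun t ht => ht.2.1⟩
  set c := sSup S
  have hac : a ≤ c := hlub.1 haS
  have hcb : c ≤ b := hlub.2 fun t ht => ht.2.1
  have hRc : R a c := by
    rcases hac.eq_or_lt with h | h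
    · rw [← h]; exact hrefl a
    · obtain ⟨l, hlc, hlsub⟩ := (mem_nhdsLT_iff_exists_Ioo_subset' h).mp (hl c h hcb)
      obtain ⟨t, htS, hlt, htc⟩ := hlub.exists_between hlc
      rcases htc.eq_or_lt with h1 | h1
      · rw [← h1]; exact htS.2.2
      · exact htrans a t c htS.1 htc htS.2.2 (hlsub ⟨hlt, h1⟩)
  rcases hcb.eq_or_lt with h | h
  · rwa [← h]
  · obtain ⟨r, hcr, hrsub⟩ := (mem_nhdsGT_iff_exists_Ioo_subset' h).mp (hr c hac h)
    obtain ⟨t, hct, ht⟩ := exists_between (lt_min hcr h)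
    have : t ∈ S := ⟨hac.trans hct.le, (ht.trans_le (min_le_right _ _)).le,
      htrans a c t hac hct.le hRc (hrsub ⟨hct, ht.trans_le (min_le_left _ _)⟩)⟩
    exact absurd (hlub.1 this) hct.not_ge

section Steps

variable {C D : Type*} [HasEnds C] [HasEnds D] {N : I → C} {a b c : I} {ts : List I}

/-- `N` is a step function on `[a, b]`: to the right of each time it takes the target, to the left
the source of the current value. -/
def StepOn (N : I → C) (a b : I) : Prop :=
  (∀ s, a ≤ s → s < b → ∀ᶠ t in 𝓝[>] s, N t = tgt (N s)) ∧
    ∀ s, a < s → s ≤ b → ∀ᶠ t in 𝓝[<] s, N t = src (N s)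

theorem StepOn.refl (N : I → C) (a : I) : StepOn N a a :=
  ⟨fun _ h h' => absurd h' h.not_gt, fun _ h h' => absurd h h'.not_gt⟩

theorem StepOn.trans (h : StepOn N a b) (h' : StepOn N b c) : StepOn N a c := by
  refine ⟨fun s h1 h2 => ?_, fun s h1 h2 => ?_⟩
  · rcases lt_or_ge s b with h3 | h3
    · exact h.1 s h1 h3
    · exact h'.1 s h3 h2
  · rcases lt_or_ge b s with h3 | h3
    · exact h'.2 s h3 h2
    · exact h.2 s h1 h3

theorem StepOn.mono (h : StepOn N a b) {a' b' : I} (ha : a ≤ a') (hb : b' ≤ b) :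
    StepOn N a' b' :=
  ⟨fun s h1 h2 => h.1 s (ha.trans h1) (h2.trans_le hb),
    fun s h1 h2 => h.2 s (ha.trans_lt h1) (h2.trans hb)⟩

theorem eventually_mem_Icc_right {s : I} (h1 : a ≤ s) (h2 : s < b) :
    ∀ᶠ t in 𝓝[>] s, t ∈ Icc a b := by
  filter_upwards [Ioo_mem_nhdsGT h2] with t ht
  exact ⟨h1.trans ht.1.le, ht.2.le⟩

theorem eventually_mem_Icc_left {s : I} (h1 : a < s) (h2 : s ≤ b) :
    ∀ᶠ t in 𝓝[<] s, t ∈ Icc a b := by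
  filter_upwards [Ioo_mem_nhdsLT h1] with t ht
  exact ⟨ht.1.le, ht.2.le.trans h2⟩

theorem StepOn.map {F : I → D} (h : StepOn N a b) (f : C → D)
    (hs : ∀ c, f (src c) = src (f c)) (ht : ∀ c, f (tgt c) = tgt (f c))
    (hF : ∀ t ∈ Icc a b, F t = f (N t)) : StepOn F a b := by
  refine ⟨fun s h1 h2 => ?_, fun s h1 h2 => ?_⟩
  · filter_upwards [h.1 s h1 h2, eventually_mem_Icc_right h1 h2] with t h3 h4
    rw [hF t h4, hF s ⟨h1, h2.le⟩, h3, ht]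
  · filter_upwards [h.2 s h1 h2, eventually_mem_Icc_left h1 h2] with t h3 h4
    rw [hF t h4, hF s ⟨h1.le, h2⟩, h3, hs]

theorem StepOn.congr {F : I → C} (h : StepOn N a b) (hF : ∀ t ∈ Icc a b, F t = N t) :
    StepOn F a b := h.map id (fun _ => rfl) (fun _ => rfl) hF

/-- The points of `ts` subdivide `[a, b]` into intervals in whose interior `N` is constant. -/
def Steps (N : I → C) : I → List I → I → Prop
  | a, [], b => a = b
  | a, m :: ts, b => a < m ∧ (∀ t ∈ Ioo a m, N t = tgt (N a)) ∧ tgt (N a) = src (N m) ∧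
      Steps N m ts b

theorem Steps.le (h : Steps N a ts b) : a ≤ b := by
  induction ts generalizing a with
  | nil => exact le_of_eq h
  | cons m ts ih => exact h.1.le.trans (ih h.2.2.2)

theorem steps_append {ts' : List I} :
    Steps N a (ts ++ ts') b ↔ ∃ m, Steps N a ts m ∧ Steps N m ts' b := by
  induction ts generalizing a with
  | nil => simp [Steps]
  | cons m ts ih => simp only [List.cons_append, Steps, ih]; grind

/-- Finite subdivisions can be concatenated, so it suffices to find them locally; on each side of a
point a single division point is enough. -/
theorem StepOn.exists_steps (h : StepOn N a b) (hab : a ≤ b) : ∃ ts, Steps N a ts b := by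
  refine unitInterval.rel_of_local (fun a b => ∃ ts, Steps N a ts b) (fun a => ⟨[], rfl⟩) ?_ hab
    (fun s h1 h2 => ?_) (fun s h1 h2 => ?_)
  · rintro a b c - - ⟨ts, h1⟩ ⟨ts', h2⟩
    exact ⟨ts ++ ts', steps_append.mpr ⟨b, h1, h2⟩⟩
  · obtain ⟨r, hsr, hr⟩ := (mem_nhdsGT_iff_exists_Ioo_subset' h2).mp (h.1 s h1 h2)
    filter_upwards [Ioo_mem_nhdsGT hsr] with t ht
    have hN : ∀ u ∈ Ioc s t, N u = tgt (N s) := fun u hu => hr ⟨hu.1, hu.2.trans_lt ht.2⟩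
    exact ⟨[t], ht.1, fun u hu => hN u ⟨hu.1, hu.2.le⟩,
      by rw [hN t ⟨ht.1, le_rfl⟩, src_tgt], rfl⟩
  · obtain ⟨r, hrs, hr⟩ := (mem_nhdsLT_iff_exists_Ioo_subset' h1).mp (h.2 s h1 h2)
    filter_upwards [Ioo_mem_nhdsLT hrs] with t ht
    have hN : ∀ u ∈ Ico t s, N u = src (N s) := fun u hu => hr ⟨ht.1.trans_le hu.1, hu.2⟩
    have ht' : tgt (N t) = src (N s) := by rw [hN t ⟨le_rfl, ht.2⟩, tgt_src]
    exact ⟨[s], ht.2, fun u hu => by rw [ht']; exact hN u ⟨hu.1.le, hu.2⟩, ht', rfl⟩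

open Classical in
/-- The cells of positive dimension in a list. -/
noncomputable def nonVertices (l : List C) : List C := l.filter fun c => src c ≠ c

theorem nonVertices_nil : nonVertices ([] : List C) = [] := rfl

theorem nonVertices_cons_of_eq {c : C} {l : List C} (h : src c = c) :
    nonVertices (c :: l) = nonVertices l := by simp [nonVertices, h]

theorem nonVertices_cons_of_ne {c : C} {l : List C} (h : src c ≠ c) :
    nonVertices (c :: l) = c :: nonVertices l := by simp [nonVertices, h]

theorem nonVertices_append (l l' : List C) :
    nonVertices (l ++ l') = nonVertices l ++ nonVertices l' := by simp [nonVertices]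

theorem nonVertices_map (f : C → D) (hf : ∀ c, src (f c) = f c ↔ src c = c) (l : List C) :
    nonVertices (l.map f) = (nonVertices l).map f := by
  unfold nonVertices
  rw [List.filter_map]
  congr 1
  exact List.filter_congr fun c _ => by simp [hf]

/-- Consecutive values are linked at the division points. A vertex among them is its own source and
target, so omitting it does not break the chain. -/
theorem Steps.chain (h : Steps N a ts b) :
    Chain (tgt (N a)) (nonVertices (ts.map N)) (tgt (N b)) := by
  induction ts generalizing a with
  | nil => rw [show a = b from h]; rfl
  | cons m ts ih =>
    obtain ⟨-, -, h3, h4⟩ := h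
    by_cases hm : src (N m) = N m
    · rw [List.map_cons, nonVertices_cons_of_eq hm, h3, hm]
      have := ih h4
      rwa [tgt_of_src _ hm] at this
    · rw [List.map_cons, nonVertices_cons_of_ne hm]
      exact ⟨hm, h3.symm, ih h4⟩

theorem Steps.map {F : I → D} (h : Steps N a ts b) (f : C → D)
    (hs : ∀ c, f (src c) = src (f c)) (ht : ∀ c, f (tgt c) = tgt (f c))
    (hF : ∀ t ∈ Icc a b, F t = f (N t)) :
    Steps F a ts b ∧ ts.map F = (ts.map N).map f := by
  induction ts generalizing a with
  | nil => exact ⟨h, rfl⟩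
  | cons m ts ih =>
    obtain ⟨h1, h2, h3, h4⟩ := h
    have hmb := h4.le
    obtain ⟨h5, h6⟩ := ih h4 fun t h => hF t ⟨h1.le.trans h.1, h.2⟩
    have ha : F a = f (N a) := hF a ⟨le_rfl, h1.le.trans hmb⟩
    have hm : F m = f (N m) := hF m ⟨h1.le, hmb⟩
    refine ⟨⟨h1, fun t h => ?_, by rw [ha, hm, ← ht, ← hs, h3], h5⟩, ?_⟩
    · rw [hF t ⟨h.1.le, h.2.le.trans hmb⟩, h2 t h, ha, ht]
    · rw [List.map_cons, h6, hm, List.map_cons, List.map_cons]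

/-- A subdivision may be cut at a time at which the value is a vertex. -/
theorem Steps.exists_cut {l₁ l₂ : List C} (h : Steps N a ts b) (ha : src (N a) = N a)
    (hb : src (N b) = N b) (hl : nonVertices (ts.map N) = l₁ ++ l₂) :
    ∃ m ts₁ ts₂, Steps N a ts₁ m ∧ Steps N m ts₂ b ∧ src (N m) = N m ∧
      nonVertices (ts₁.map N) = l₁ ∧ nonVertices (ts₂.map N) = l₂ := by
  induction ts generalizing a l₁ with
  | nil =>
    obtain ⟨rfl, rfl⟩ := List.append_eq_nil_iff.mp hl.symm
    exact ⟨b, [], [], h, rfl, hb, rfl, rfl⟩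
  | cons m ts ih =>
    rcases l₁ with _ | ⟨c, l₁⟩
    · exact ⟨a, [], m :: ts, rfl, h, ha, rfl, hl⟩
    obtain ⟨h1, h2, h3, h4⟩ := h
    by_cases hm : src (N m) = N m
    · rw [List.map_cons, nonVertices_cons_of_eq hm] at hl
      obtain ⟨m', ts₁, ts₂, h5, h6, h7, h8, h9⟩ := ih h4 hm hl
      refine ⟨m', m :: ts₁, ts₂, ⟨h1, h2, h3, h5⟩, h6, h7, ?_, h9⟩
      rw [List.map_cons, nonVertices_cons_of_eq hm, h8]
    · rw [List.map_cons, nonVertices_cons_of_ne hm, List.cons_append] at hl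
      obtain ⟨rfl, hl'⟩ := List.cons.inj hl
      -- There is a further division point, since the value at `m` is not a vertex while the value
      -- at `b` is. Between the two the value is the constant vertex `tgt (N m)`, so an extra
      -- division point `q` can be inserted there.
      rcases ts with _ | ⟨m', ts⟩
      · rw [show m = b from h4] at hm
        exact absurd hb hm
      obtain ⟨h5, h6, h7, h8⟩ := h4
      obtain ⟨q, hq1, hq2⟩ := exists_between h5
      have hq : N q = tgt (N m) := h6 q ⟨hq1, hq2⟩
      have hq' : tgt (N q) = tgt (N m) := by rw [hq, tgt_tgt]
      obtain ⟨k, ts₁, ts₂, g1, g2, g3, g4, g5⟩ := ih (a := q)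
        ⟨hq2, fun t ht => by rw [hq']; exact h6 t ⟨hq1.trans ht.1, ht.2⟩, by rw [hq', h7], h8⟩
        (by rw [hq, src_tgt]) hl'
      refine ⟨k, m :: q :: ts₁, ts₂, ⟨h1, h2, h3, hq1, ?_, ?_, g1⟩, g2, g3, ?_, g5⟩
      · exact fun t ht => h6 t ⟨ht.1, ht.2.trans hq2⟩
      · rw [hq, src_tgt]
      · rw [List.map_cons, nonVertices_cons_of_ne hm, List.map_cons,
          nonVertices_cons_of_eq (by rw [hq, src_tgt]), g4]

theorem Steps.lt_of_mem (h : Steps N a ts b) {t : I} (ht : t ∈ ts) : a < t := by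
  induction ts generalizing a with
  | nil => simp at ht
  | cons m ts ih =>
    rcases List.mem_cons.mp ht with rfl | ht
    · exact h.1
    · exact h.1.trans (ih h.2.2.2 ht)

theorem Steps.pairwise_lt (h : Steps N a ts b) : ts.Pairwise (· < ·) := by
  induction ts generalizing a with
  | nil => exact List.Pairwise.nil
  | cons m ts ih =>
    exact List.Pairwise.cons (fun t ht => h.2.2.2.lt_of_mem ht) (ih h.2.2.2)

theorem Steps.mem_of_ne (h : Steps N a ts b) {t : I} (hat : a < t) (htb : t ≤ b)
    (ht : src (N t) ≠ N t) : t ∈ ts := by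
  induction ts generalizing a with
  | nil => rw [show a = b from h] at hat; exact absurd hat htb.not_gt
  | cons m ts ih =>
    obtain ⟨h1, h2, h3, h4⟩ := h
    rcases lt_trichotomy t m with h5 | h5 | h5
    · rw [h2 t ⟨hat, h5⟩, src_tgt] at ht
      exact absurd rfl ht
    · simp [h5]
    · exact List.mem_cons_of_mem _ (ih h4 h5)

end Steps

/-! ### Nearest faces along increasing paths -/

namespace CubeFace

variable {n : ℕ}

theorem nearest_of_lt {x : Fin n → I} {i : Fin n} (h : (x i : ℝ) < 1 / 2) :
    nearest x i = some false := by rw [nearest, if_pos h]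

theorem nearest_of_gt {x : Fin n → I} {i : Fin n} (h : 1 / 2 < (x i : ℝ)) :
    nearest x i = some true := by rw [nearest, if_neg h.not_gt, if_pos h]

theorem nearest_of_eq {x : Fin n → I} {i : Fin n} (h : (x i : ℝ) = 1 / 2) :
    nearest x i = none := by rw [nearest, if_neg h.not_lt, if_neg h.not_gt]

theorem isOpen_collar (J : CubeFace n) : IsOpen (collar J) := by
  have : collar J = ⋂ i, {x : Fin n → I | (J i = some false → (x i : ℝ) < 1 / 2) ∧
      (J i = some true → 1 / 2 < (x i : ℝ))} := by
    ext x
    simp [collar]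
  rw [this]
  refine isOpen_iInter_of_finite fun i => ?_
  rcases J i with _ | _ | _
  · simp
  · simpa using isOpen_lt (f := fun x : Fin n → I => (x i : ℝ)) (by fun_prop) continuous_const
  · simpa using isOpen_lt (g := fun x : Fin n → I => (x i : ℝ)) continuous_const (by fun_prop)

/-- An increasing path in a cube that meets each middle hyperplane at most once gives a step
function. -/
theorem stepOn_nearest {β : I → Fin n → I} {a b : I} (hc : ContinuousOn β (Icc a b))
    (hm : MonotoneOn β (Icc a b))
    (hβ : ∀ i, ∀ s ∈ Icc a b, ∀ t ∈ Icc a b, (β s i : ℝ) = 1 / 2 → (β t i : ℝ) = 1 / 2 → s = t) :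
    StepOn (fun t => nearest (β t)) a b := by
  have hlim : ∀ s ∈ Icc a b, ∀ l : Filter I, l ≤ 𝓝[Icc a b] s → ∀ i,
      Tendsto (fun t => (β t i : ℝ)) l (𝓝 (β s i : ℝ)) := fun s hs l hl i =>
    ((continuous_subtype_val.tendsto _).comp
      (((continuous_apply i).tendsto _).comp ((hc s hs).mono_left hl)))
  constructor
  · intro s h1 h2
    have hs : s ∈ Icc a b := ⟨h1, h2.le⟩
    have hev := eventually_mem_Icc_right h1 h2
    have hl : 𝓝[>] s ≤ 𝓝[Icc a b] s := le_inf inf_le_left (le_principal_iff.mpr hev)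
    have : ∀ i, ∀ᶠ t in 𝓝[>] s, nearest (β t) i = tgt (nearest (β s)) i := by
      intro i
      rw [tgt_apply]
      -- A coordinate off `1/2` stays on its side by continuity. A coordinate equal to `1/2` exceeds
      -- it immediately afterwards, by monotonicity and because `1/2` is attained only once.
      rcases lt_trichotomy (β s i : ℝ) (1 / 2) with h | h | h
      · filter_upwards [(hlim s hs _ hl i).eventually_lt_const h] with t ht
        rw [nearest_of_lt h, nearest_of_lt ht]; rfl
      · filter_upwards [hev, self_mem_nhdsWithin] with t ht hst
        have h3 : (β s i : ℝ) ≤ β t i := hm hs ht (le_of_lt hst) i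
        rw [nearest_of_eq h, nearest_of_gt]
        · rfl
        · exact lt_of_le_of_ne (h ▸ h3) fun h4 => (ne_of_lt hst) (hβ i s hs t ht h h4.symm)
      · filter_upwards [(hlim s hs _ hl i).eventually_const_lt h] with t ht
        rw [nearest_of_gt h, nearest_of_gt ht]; rfl
    filter_upwards [eventually_all.mpr this] with t ht
    exact funext ht
  · intro s h1 h2
    have hs : s ∈ Icc a b := ⟨h1.le, h2⟩
    have hev := eventually_mem_Icc_left h1 h2
    have hl : 𝓝[<] s ≤ 𝓝[Icc a b] s := le_inf inf_le_left (le_principal_iff.mpr hev)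
    have : ∀ i, ∀ᶠ t in 𝓝[<] s, nearest (β t) i = src (nearest (β s)) i := by
      intro i
      rw [src_apply]
      rcases lt_trichotomy (β s i : ℝ) (1 / 2) with h | h | h
      · filter_upwards [(hlim s hs _ hl i).eventually_lt_const h] with t ht
        rw [nearest_of_lt h, nearest_of_lt ht]; rfl
      · filter_upwards [hev, self_mem_nhdsWithin] with t ht hst
        have h3 : (β t i : ℝ) ≤ β s i := hm ht hs (le_of_lt hst) i
        rw [nearest_of_eq h, nearest_of_lt]
        · rfl
        · exact lt_of_le_of_ne (h ▸ h3) fun h4 => (ne_of_lt hst) (hβ i t ht s hs h4 h)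
      · filter_upwards [(hlim s hs _ hl i).eventually_const_lt h] with t ht
        rw [nearest_of_gt h, nearest_of_gt ht]; rfl
    filter_upwards [eventually_all.mpr this] with t ht
    exact funext ht

end CubeFace

/-! ### Presentations and the trace of a path -/

namespace PrecubicalSet

variable {X : PrecubicalSet.{u}} {p : I → X.Realization} {a b : I}

namespace Presentation

/-- The presentation of a path on a one point interval. -/
def nil (p : I → X.Realization) (a : I) : X.Presentation p a a where
  len := 0
  time _ := a
  time_mono _ _ _ := le_rfl
  time_zero := rfl
  time_last := rfl
  dim k := k.elim0
  cube k := k.elim0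
  path k := k.elim0
  path_cont k := k.elim0
  path_mono k := k.elim0
  eq_pt k := k.elim0

/-- Extend a presentation to the left by one interval. -/
def cons {m : I} (ham : a ≤ m) {n : ℕ} (c : X.cube n) (β : I → Fin n → I)
    (hc : ContinuousOn β (Icc a m)) (hm : MonotoneOn β (Icc a m))
    (hp : ∀ t ∈ Icc a m, p t = X.pt c (β t)) (P : X.Presentation p m b) :
    X.Presentation p a b where
  len := P.len + 1
  time := Fin.cons a P.time
  time_mono := by
    rw [Fin.monotone_iff_le_succ]
    refine Fin.cases ?_ fun k => ?_
    · rw [Fin.castSucc_zero, Fin.cons_zero, Fin.cons_succ, P.time_zero]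
      exact ham
    · rw [← Fin.succ_castSucc, Fin.cons_succ, Fin.cons_succ]
      exact P.time_mono (Fin.castSucc_le_succ k)
  time_zero := rfl
  time_last := by rw [← Fin.succ_last, Fin.cons_succ, P.time_last]
  -- Dimension, cube and path are extended by the same `Fin.cons` of triples, because the types of
  -- the last two depend on the first.
  dim k := (Fin.cons (α := fun _ => Σ n, X.cube n × (I → Fin n → I)) ⟨n, c, β⟩
    (fun k => ⟨P.dim k, P.cube k, P.path k⟩) k).1
  cube k := (Fin.cons (α := fun _ => Σ n, X.cube n × (I → Fin n → I)) ⟨n, c, β⟩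
    (fun k => ⟨P.dim k, P.cube k, P.path k⟩) k).2.1
  path k := (Fin.cons (α := fun _ => Σ n, X.cube n × (I → Fin n → I)) ⟨n, c, β⟩
    (fun k => ⟨P.dim k, P.cube k, P.path k⟩) k).2.2
  path_cont := by
    refine Fin.cases ?_ fun k => ?_
    · rw [Fin.castSucc_zero, Fin.cons_zero, Fin.cons_succ, P.time_zero]
      exact hc
    · rw [← Fin.succ_castSucc, Fin.cons_succ, Fin.cons_succ]
      exact P.path_cont k
  path_mono := by
    refine Fin.cases ?_ fun k => ?_
    · rw [Fin.castSucc_zero, Fin.cons_zero, Fin.cons_succ, P.time_zero]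
      exact hm
    · rw [← Fin.succ_castSucc, Fin.cons_succ, Fin.cons_succ]
      exact P.path_mono k
  eq_pt := by
    refine Fin.cases ?_ fun k => ?_
    · rw [Fin.castSucc_zero, Fin.cons_zero, Fin.cons_succ, P.time_zero]
      exact hp
    · rw [← Fin.succ_castSucc, Fin.cons_succ, Fin.cons_succ]
      exact P.eq_pt k

section cons

variable {m : I} (ham : a ≤ m) {n : ℕ} (c : X.cube n) (β : I → Fin n → I)
    (hc : ContinuousOn β (Icc a m)) (hm : MonotoneOn β (Icc a m))
    (hp : ∀ t ∈ Icc a m, p t = X.pt c (β t)) {P : X.Presentation p m b}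

theorem IsStrict.cons (hP : P.IsStrict)
    (hβ : ∀ i, ∀ s ∈ Icc a m, ∀ t ∈ Icc a m, β s i = β t i → s = t) :
    (P.cons ham c β hc hm hp).IsStrict := by
  have h0 : P.time 0 = m := P.time_zero
  refine Fin.cases ?_ fun k => ?_
  · intro i s hs t ht h
    refine Or.inl (hβ i s ?_ t ?_ h)
    · rw [← h0]; exact hs
    · rw [← h0]; exact ht
  · exact hP k

theorem IsTame.cons (hP : P.IsTame) (ha : ∃ v : X.cube 0, p a = X.vertexPt v) :
    (P.cons ham c β hc hm hp).IsTame := by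
  refine Fin.cases ha fun k => hP k

end cons

/-- A reflexive and transitive relation that holds on the intervals of a presentation holds on the
whole interval. -/
theorem rel (P : X.Presentation p a b) (R : I → I → Prop) (hrefl : ∀ s, R s s)
    (htrans : ∀ r s t, r ≤ s → s ≤ t → R r s → R s t → R r t)
    (h : ∀ k : Fin P.len, R (P.time k.castSucc) (P.time k.succ)) : R a b := by
  have key : ∀ k : Fin (P.len + 1), R a (P.time k) := by
    intro k
    induction k using Fin.induction with
    | zero => rw [P.time_zero]; exact hrefl a
    | succ k ih =>
      exact htrans _ _ _ (P.time_zero.symm.le.trans (P.time_mono (Fin.zero_le _)))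
        (P.time_mono (Fin.castSucc_le_succ k)) ih (h k)
  rw [← P.time_last]
  exact key _

theorem time_mem (P : X.Presentation p a b) (k : Fin (P.len + 1)) : P.time k ∈ Icc a b := by
  constructor
  · exact P.time_zero.symm.le.trans (P.time_mono (Fin.zero_le _))
  · exact (P.time_mono (Fin.le_last _)).trans P.time_last.le

/-- Reverse induction on the presentation interval, starting from the end: the part of the current
interval inside `[a', b']` is prepended to a presentation of the rest. -/
theorem restrict (P : X.Presentation p a b) {a' b' : I} (ha : a ≤ a') (hab : a' ≤ b')
    (hb : b' ≤ b) : Nonempty (X.Presentation p a' b') := by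
  have key : ∀ k : Fin (P.len + 1), ∀ a', P.time k ≤ a' → a' ≤ b' →
      Nonempty (X.Presentation p a' b') := by
    intro k
    induction k using Fin.reverseInduction with
    | last =>
      intro a' h1 h2
      rw [P.time_last] at h1
      obtain rfl : a' = b' := le_antisymm h2 (hb.trans h1)
      exact ⟨nil p a'⟩
    | cast k ih =>
      intro a' h1 h2
      rcases le_total (P.time k.succ) a' with h3 | h3
      · exact ih a' h3 h2
      · have hQ : ∀ m, m ≤ P.time k.succ → a' ≤ m → Nonempty (X.Presentation p m b') →
            Nonempty (X.Presentation p a' b') := by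
          rintro m hm ham ⟨Q⟩
          have hsub : Icc a' m ⊆ Icc (P.time k.castSucc) (P.time k.succ) :=
            Icc_subset_Icc h1 hm
          exact ⟨Q.cons ham (P.cube k) (P.path k) ((P.path_cont k).mono hsub)
            ((P.path_mono k).mono hsub) fun t ht => P.eq_pt k t (hsub ht)⟩
        rcases le_total b' (P.time k.succ) with h4 | h4
        · exact hQ b' h4 h2 ⟨nil p b'⟩
        · exact hQ _ le_rfl h3 (ih _ le_rfl h4)
  exact key 0 a' (P.time_zero.le.trans ha) hab

end Presentation

/-- The smallest cube whose collar contains the point of the path `p` at time `t`. -/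
noncomputable def trace (p : I → X.Realization) (t : I) : X.Cell := X.nearestFace (p t)

theorem nearestFace_pt {n : ℕ} (c : X.cube n) (x : Fin n → I) :
    X.nearestFace (X.pt c x) = X.iterFace (CubeFace.nearest x) c := rfl

theorem Presentation.trace_eq (P : X.Presentation p a b) (k : Fin P.len) {t : I}
    (ht : t ∈ Icc (P.time k.castSucc) (P.time k.succ)) :
    trace p t = X.iterFace (CubeFace.nearest (P.path k t)) (P.cube k) := by
  rw [trace, P.eq_pt k t ht, nearestFace_pt]

theorem stepOn_trace {n : ℕ} {c : X.cube n} {G : I → CubeFace n} (hG : StepOn G a b)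
    (h : ∀ t ∈ Icc a b, trace p t = X.iterFace (G t) c) : StepOn (trace p) a b :=
  hG.map (fun G => X.iterFace G c) (fun G => (X.src_iterFace G c).symm)
    (fun G => (X.tgt_iterFace G c).symm) h

/-- A strict coordinate takes the value `1/2` at most once on each interval, since it may rest only
at `0` and `1`. -/
theorem Presentation.IsStrict.stepOn_trace {P : X.Presentation p a b} (hP : P.IsStrict) :
    StepOn (trace p) a b := by
  refine P.rel _ (fun s => StepOn.refl _ s) (fun r s t _ _ h h' => h.trans h') fun k => ?_
  refine PrecubicalSet.stepOn_trace
    (CubeFace.stepOn_nearest (P.path_cont k) (P.path_mono k) ?_) fun t ht => P.trace_eq k ht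
  intro i s hs t ht h1 h2
  rcases hP k i s hs t ht (Subtype.ext (h1.trans h2.symm)) with h | h | h
  · exact h
  · rw [h] at h1; norm_num at h1
  · rw [h] at h1; norm_num at h1

/-- If the trace of a path is a step function, then so is the sequence of nearest faces in any
presentation. -/
theorem Presentation.stepOn_nearest (P : X.Presentation p a b) (h : StepOn (trace p) a b)
    (k : Fin P.len) :
    StepOn (fun t => CubeFace.nearest (P.path k t)) (P.time k.castSucc) (P.time k.succ) := by
  -- The presentation need not be strict. If a coordinate were `1/2` at two times, then by
  -- monotonicity also in between, and the trace would have positive dimension just after the first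
  -- time, where a step function takes a vertex as its value.
  have hlt : ∀ i, ∀ s ∈ Icc (P.time k.castSucc) (P.time k.succ),
      ∀ t ∈ Icc (P.time k.castSucc) (P.time k.succ), (P.path k s i : ℝ) = 1 / 2 →
      (P.path k t i : ℝ) = 1 / 2 → ¬ s < t := by
    intro i s hs t ht h1 h2 hst
    have hsr := h.1 s ((P.time_mem _).1.trans hs.1)
      (hst.trans_le (ht.2.trans (P.time_mem _).2))
    have := nhdsGT_neBot_of_exists_gt ⟨t, hst⟩
    obtain ⟨r, hr, hr1, hr2⟩ := (hsr.and (Ioo_mem_nhdsGT hst)).exists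
    have hrk : r ∈ Icc (P.time k.castSucc) (P.time k.succ) :=
      ⟨hs.1.trans hr1.le, hr2.le.trans ht.2⟩
    have hri : (P.path k r i : ℝ) = 1 / 2 := by
      apply le_antisymm
      · rw [← h2]; exact P.path_mono k hrk ht hr2.le i
      · rw [← h1]; exact P.path_mono k hs hrk hr1.le i
    have h5 : src (trace p r) = trace p r := by rw [hr, src_tgt]
    rw [P.trace_eq k hrk, X.src_iterFace_eq_iff, CubeFace.src_eq_self_iff] at h5
    exact h5 i (CubeFace.nearest_of_eq hri)
  refine CubeFace.stepOn_nearest (P.path_cont k) (P.path_mono k) ?_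
  intro i s hs t ht h1 h2
  exact le_antisymm (not_lt.mp (hlt i t ht s hs h2 h1)) (not_lt.mp (hlt i s hs t ht h1 h2))

/-! ### Paths in the collar of one cube -/

theorem RunsInCollar.ne {e : X.Cell} (h : X.RunsInCollar p e a b) (he : 0 < e.1) : a ≠ b := by
  rintro rfl
  obtain ⟨P, F, h1, h2, -⟩ := h
  have := congrFun (h1.symm.trans h2) ⟨0, he⟩
  simp [CubeFace.corner] at this

/-- In a collar of `e`, the face `F t` of `I^n` determines the trace. -/
theorem Presentation.trace_eq_of_local {e : X.Cell} (P : X.Presentation p a b)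
    {F : I → CubeFace e.1} {k : Fin P.len} {t : I}
    (ht : t ∈ Icc (P.time k.castSucc) (P.time k.succ)) {J : CubeFace (P.dim k)} {K : CubeFace e.1}
    {φ : {j : Fin (P.dim k) // J j = none} ≃o {i : Fin e.1 // K i = none}}
    (hJK : X.iterFace J (P.cube k) = X.iterFace K e.2) (hJ : P.path k t ∈ CubeFace.collar J)
    (hF : F t = CubeFace.transfer J K φ (CubeFace.nearest (P.path k t))) :
    trace p t = X.iterFace (F t) e.2 := by
  rw [hF, X.iterFace_transfer φ hJK (CubeFace.mem_collar_iff.mp hJ), P.trace_eq k ht]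

/-- The faces `F t` along a path in a collar determine the trace. -/
theorem RunsInCollar.exists_face {e : X.Cell} (h : X.RunsInCollar p e a b) (hab : a < b) :
    ∃ F : I → CubeFace e.1, F a = CubeFace.corner e.1 false ∧ F b = CubeFace.corner e.1 true ∧
      (∀ t ∈ Icc a b, trace p t = X.iterFace (F t) e.2) ∧
      (StepOn (trace p) a b → StepOn F a b) := by
  obtain ⟨P, F, h1, h2, h3⟩ := h
  refine ⟨F, h1, h2, ?_, fun hstep => ?_⟩
  -- The guard `u < v` makes the relation reflexive: a presentation of a one-point interval may have
  -- no pieces and then says nothing about `F`.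
  · refine P.rel (fun u v => u < v → ∀ t ∈ Icc u v, trace p t = X.iterFace (F t) e.2)
      (fun s h => absurd h (lt_irrefl s)) ?_ (fun k hk t ht => ?_) hab
    · intro r s t hrs hst h h' hrt q hq
      rcases hrs.eq_or_lt with rfl | hrs
      · exact h' hrt q hq
      rcases hst.eq_or_lt with rfl | hst
      · exact h hrs q hq
      rcases le_total q s with hqs | hqs
      · exact h hrs q ⟨hq.1, hqs⟩
      · exact h' hst q ⟨hqs, hq.2⟩
    · obtain ⟨J, K, φ, hJK, hev⟩ := h3 k t ht
      have := hev.self_of_nhdsWithin ht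
      exact P.trace_eq_of_local ht hJK this.1 this.2
  · refine P.rel _ (fun s => StepOn.refl _ s) (fun r s t _ _ h h' => h.trans h') fun k => ?_
    have hk := P.stepOn_nearest hstep k
    refine ⟨fun s hs1 hs2 => ?_, fun s hs1 hs2 => ?_⟩
    · have hs : s ∈ Icc (P.time k.castSucc) (P.time k.succ) := ⟨hs1, hs2.le⟩
      -- The same `J`, `K` and `φ` describe `F` at `s` and near `s`, and transfer commutes with
      -- targets, so `F` inherits the steps of the nearest faces.
      obtain ⟨J, K, φ, hJK, hev⟩ := h3 k s hs
      have hle : 𝓝[>] s ≤ 𝓝[Icc (P.time k.castSucc) (P.time k.succ)] s :=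
        le_inf inf_le_left (le_principal_iff.mpr (eventually_mem_Icc_right hs1 hs2))
      filter_upwards [hk.1 s hs1 hs2, hle hev] with t ht1 ht2
      rw [ht2.2, (hev.self_of_nhdsWithin hs).2, ht1, CubeFace.tgt_transfer]
    · have hs : s ∈ Icc (P.time k.castSucc) (P.time k.succ) := ⟨hs1.le, hs2⟩
      obtain ⟨J, K, φ, hJK, hev⟩ := h3 k s hs
      have hle : 𝓝[<] s ≤ 𝓝[Icc (P.time k.castSucc) (P.time k.succ)] s :=
        le_inf inf_le_left (le_principal_iff.mpr (eventually_mem_Icc_left hs1 hs2))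
      filter_upwards [hk.2 s hs1 hs2, hle hev] with t ht1 ht2
      rw [ht2.2, (hev.self_of_nhdsWithin hs).2, ht1, CubeFace.src_transfer]

/-- The subdivision is taken for `F`, not for the trace: the values of `F` form a chain of faces
from corner to corner, and its image in `X` is the chain of the trace. -/
theorem RunsInCollar.exists_steps {e : X.Cell} (h : X.RunsInCollar p e a b) (hab : a < b)
    (hstep : StepOn (trace p) a b) :
    ∃ ts, Steps (trace p) a ts b ∧ RefinesCell e (nonVertices (ts.map (trace p))) := by
  obtain ⟨F, h1, h2, h3, h4⟩ := h.exists_face hab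
  obtain ⟨ts, hts⟩ := (h4 hstep).exists_steps hab.le
  obtain ⟨h5, h6⟩ := hts.map (F := trace p) (fun G => X.iterFace G e.2)
    (fun G => (X.src_iterFace G e.2).symm) (fun G => (X.tgt_iterFace G e.2).symm) h3
  refine ⟨ts, h5, nonVertices (ts.map F), ?_, ?_⟩
  · have := hts.chain
    rw [h1, h2] at this
    exact this
  · rw [h6, nonVertices_map _ fun G => X.src_iterFace_eq_iff]

/-- A chain of faces of `e` whose image is the sequence of values of the step function `N` lifts
`N` to a step function with values in the faces of `e`. -/
theorem steps_exists_lift {e : X.Cell} {N : I → X.Cell} {ts : List I} (h : Steps N a ts b)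
    {G w : CubeFace e.1} (hG : N a = X.iterFace G e.2) {L : List (CubeFace e.1)}
    (hL : Chain (tgt G) L w)
    (hmap : L.map (fun G => X.iterFace G e.2) = nonVertices (ts.map N)) :
    ∃ F : I → CubeFace e.1, F a = G ∧ tgt (F b) = w ∧ StepOn F a b ∧
      ∀ t ∈ Icc a b, N t = X.iterFace (F t) e.2 := by
  induction ts generalizing a G L with
  | nil =>
    obtain rfl : a = b := h
    obtain rfl : L = [] := by simpa [nonVertices_nil] using hmap
    refine ⟨fun _ => G, rfl, hL, StepOn.refl _ _, fun t ht => ?_⟩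
    rw [Icc_self, mem_singleton_iff] at ht
    rw [ht, hG]
  | cons m ts ih =>
    obtain ⟨h1, h2, h3, h4⟩ := h
    -- extension to the left of a lift on `[m, b]`
    have key : ∀ G' : CubeFace e.1, src G' = tgt G →
        (∃ F : I → CubeFace e.1, F m = G' ∧ tgt (F b) = w ∧ StepOn F m b ∧
          ∀ t ∈ Icc m b, N t = X.iterFace (F t) e.2) →
        ∃ F : I → CubeFace e.1, F a = G ∧ tgt (F b) = w ∧ StepOn F a b ∧
          ∀ t ∈ Icc a b, N t = X.iterFace (F t) e.2 := by
      rintro G' hG' ⟨F, f1, f2, f3, f4⟩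
      have hmb := h4.le
      -- The lift is forced on the open interval before `m`: there it is the vertex `tgt G`.
      set F' : I → CubeFace e.1 := fun t => if t ≤ a then G else if t < m then tgt G else F t
        with hF'
      have e1 : F' a = G := by simp [hF']
      have e2 : ∀ t ∈ Ioo a m, F' t = tgt G := fun t ht => by
        simp [hF', ht.1.not_ge, ht.2]
      have e3 : ∀ t ∈ Icc m b, F' t = F t := fun t ht => by
        simp [hF', (h1.trans_le ht.1).not_ge, ht.1.not_gt]
      have e4 : F' m = G' := by rw [e3 m ⟨le_rfl, hmb⟩, f1]
      refine ⟨F', e1, by rw [e3 b ⟨hmb, le_rfl⟩, f2], StepOn.trans (b := m) ⟨?_, ?_⟩ (f3.congr e3),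
        fun t ht => ?_⟩
      · intro s hs1 hs2
        filter_upwards [Ioo_mem_nhdsGT hs2] with t ht
        rw [e2 t ⟨hs1.trans_lt ht.1, ht.2⟩]
        rcases hs1.eq_or_lt with rfl | hs1
        · rw [e1]
        · rw [e2 s ⟨hs1, hs2⟩, tgt_tgt]
      · intro s hs1 hs2
        filter_upwards [Ioo_mem_nhdsLT hs1] with t ht
        rw [e2 t ⟨ht.1, ht.2.trans_le hs2⟩]
        rcases hs2.eq_or_lt with rfl | hs2
        · rw [e4, hG']
        · rw [e2 s ⟨hs1, hs2⟩, src_tgt]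
      · rcases ht.1.eq_or_lt with rfl | h5
        · rw [e1, hG]
        · rcases lt_or_ge t m with h6 | h6
          · rw [e2 t ⟨h5, h6⟩, h2 t ⟨h5, h6⟩, hG, tgt_iterFace]
          · rw [e3 t ⟨h6, ht.2⟩, f4 t ⟨h6, ht.2⟩]
    -- A vertex value lifts to `tgt G` and uses no member of `L`; a value of positive dimension
    -- lifts to the next member.
    by_cases hm : src (N m) = N m
    · rw [List.map_cons, nonVertices_cons_of_eq hm] at hmap
      refine key (tgt G) (src_tgt G) (ih h4 ?_ ?_ hmap)
      · rw [← hm, ← h3, hG, tgt_iterFace]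
      · rwa [tgt_tgt]
    · rw [List.map_cons, nonVertices_cons_of_ne hm] at hmap
      obtain ⟨G', L', rfl, h5, h6⟩ := List.map_eq_cons_iff.mp hmap
      obtain ⟨-, h7, h8⟩ := hL
      exact key G' h7 (ih h4 h5.symm h8 h6)

/-- With `F` the lift of the trace, the faces required near `s` are the nearest face at `s` and `F
s`. On either side both step functions pass to sources or targets, and transfer commutes with these.
-/
theorem runsInCollar_of_steps {e : X.Cell} (P : X.Presentation p a b)
    (hstep : StepOn (trace p) a b) {ts : List I}
    (hts : Steps (trace p) a ts b) (ha : trace p a = src e) (hb : src (trace p b) = trace p b)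
    (he : RefinesCell e (nonVertices (ts.map (trace p)))) : X.RunsInCollar p e a b := by
  obtain ⟨L, hL, hmap⟩ := he
  obtain ⟨F, h1, h2, h3, h4⟩ := steps_exists_lift hts (G := CubeFace.corner e.1 false)
    (by rw [iterFace_corner]; exact ha) hL hmap
  refine ⟨P, F, h1, ?_, fun k s hs => ?_⟩
  · have hFb : src (F b) = F b := by
      rw [← X.src_iterFace_eq_iff (c := e.2), ← h4 b ⟨hts.le, le_rfl⟩, hb]
    rw [← h2, tgt_of_src _ hFb]
  · have hk := P.stepOn_nearest hstep k
    have hs' : s ∈ Icc a b :=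
      ⟨(P.time_mem _).1.trans hs.1, hs.2.trans (P.time_mem _).2⟩
    have hJK : X.iterFace (CubeFace.nearest (P.path k s)) (P.cube k) = X.iterFace (F s) e.2 := by
      rw [← P.trace_eq k hs, h4 s hs']
    obtain ⟨φ⟩ := X.exists_orderIso_of_eq hJK
    refine ⟨_, _, φ, hJK, ?_⟩
    have hself : F s = CubeFace.transfer _ _ φ (CubeFace.nearest (P.path k s)) :=
      (CubeFace.transfer_self φ).symm
    have hev : ∀ᶠ t in 𝓝 s, t ∈ Icc (P.time k.castSucc) (P.time k.succ) →
        (CubeFace.nearest (P.path k t)).IsSubface (CubeFace.nearest (P.path k s)) ∧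
        F t = CubeFace.transfer _ _ φ (CubeFace.nearest (P.path k t)) := by
      have hleft : ∀ᶠ t in 𝓝[<] s, t ∈ Icc (P.time k.castSucc) (P.time k.succ) →
          (CubeFace.nearest (P.path k t)).IsSubface (CubeFace.nearest (P.path k s)) ∧
          F t = CubeFace.transfer _ _ φ (CubeFace.nearest (P.path k t)) := by
        rcases hs.1.eq_or_lt with h0 | h0
        · filter_upwards [self_mem_nhdsWithin] with t ht ht'
          rw [h0] at ht'
          exact absurd ht'.1 (not_le.mpr ht)
        · filter_upwards [hk.2 s h0 hs.2, h3.2 s ((P.time_mem _).1.trans_lt h0) hs'.2]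
            with t ht1 ht2 _
          rw [ht1, ht2]
          exact ⟨CubeFace.src_isSubface _,
            (congrArg src hself).trans (CubeFace.src_transfer φ _)⟩
      have hright : ∀ᶠ t in 𝓝[>] s, t ∈ Icc (P.time k.castSucc) (P.time k.succ) →
          (CubeFace.nearest (P.path k t)).IsSubface (CubeFace.nearest (P.path k s)) ∧
          F t = CubeFace.transfer _ _ φ (CubeFace.nearest (P.path k t)) := by
        rcases hs.2.eq_or_lt with h0 | h0
        · filter_upwards [self_mem_nhdsWithin] with t ht ht'
          rw [← h0] at ht'
          exact absurd ht'.2 (not_le.mpr ht)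
        · filter_upwards [hk.1 s hs.1 h0, h3.1 s hs'.1 (h0.trans_le (P.time_mem _).2)]
            with t ht1 ht2 _
          rw [ht1, ht2]
          exact ⟨CubeFace.tgt_isSubface _,
            (congrArg tgt hself).trans (CubeFace.tgt_transfer φ _)⟩
      rw [eventually_nhdsWithin_iff] at hleft hright
      filter_upwards [hleft, hright] with t hl hr
      rcases lt_trichotomy t s with h | rfl | h
      · exact hl h
      · exact fun _ => ⟨CubeFace.IsSubface.refl _, hself⟩
      · exact hr h
    rw [eventually_nhdsWithin_iff]
    filter_upwards [hev] with t ht ht'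
    exact ⟨CubeFace.mem_collar_iff.mpr (ht ht').1, (ht ht').2⟩

/-! The chain of a path -/

/-- Values of positive dimension occur only at division points. The initial time is not listed among
these, whence the assumption that the trace there is a vertex. -/
theorem crossingCubes_eq {ts : List I} (h : Steps (trace p) 0 ts 1)
    (h0 : src (trace p 0) = trace p 0) :
    X.crossingCubes p = nonVertices (ts.map (trace p)) := by
  classical
  have hset : X.crossingTimes p = ((ts.filter fun t => 0 < (trace p t).1).toFinset : Set I) := by
    ext t
    simp only [List.coe_toFinset, List.mem_filter, decide_eq_true_eq, mem_ofPred_eq]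
    constructor
    · intro ht
      refine ⟨h.mem_of_ne ?_ le_top (src_ne_self_iff.mpr ht), ht⟩
      refine lt_of_le_of_ne bot_le ?_
      rintro rfl
      exact src_ne_self_iff.mpr ht h0
    · exact fun h => h.2
  have hfin : (X.crossingTimes p).Finite := by
    rw [hset]; exact Finset.finite_toSet _
  have hts : hfin.toFinset = (ts.filter fun t => 0 < (trace p t).1).toFinset := by
    rw [← Finset.coe_inj, Finite.coe_toFinset, hset]
  have hpw : (ts.filter fun t => 0 < (trace p t).1).Pairwise (· < ·) := h.pairwise_lt.filter _
  rw [crossingCubes, dif_pos hfin, hts,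
    (List.toFinset_sort _ (hpw.imp fun h => ne_of_lt h)).mpr (hpw.imp fun h => le_of_lt h)]
  unfold nonVertices
  rw [List.filter_map]
  refine congrArg (List.map _) (List.filter_congr fun t _ => ?_)
  simp [src_eq_self_iff, Nat.pos_iff_ne_zero]

theorem concatenates_exists_steps {es : List X.Cell} (hes : ∀ e ∈ es, 0 < e.1)
    (hstep : StepOn (trace p) a b) (h : Concatenates (X.RunsInCollar p) es a b) :
    ∃ ts, Steps (trace p) a ts b ∧ RefinesList es (nonVertices (ts.map (trace p))) := by
  induction es generalizing a with
  | nil => exact ⟨[], h, rfl⟩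
  | cons e es ih =>
    obtain ⟨m, ham, hmb, he, h⟩ := h
    obtain ⟨ts, h1, h2⟩ := he.exists_steps
      (lt_of_le_of_ne ham (he.ne (hes e (by simp)))) (hstep.mono le_rfl hmb)
    obtain ⟨ts', h3, h4⟩ := ih (fun c hc => hes c (by simp [hc])) (hstep.mono ham le_rfl) h
    refine ⟨ts ++ ts', steps_append.mpr ⟨m, h1, h3⟩, _, _, ?_, h2, h4⟩
    rw [List.map_append, nonVertices_append]

/-- The subdivision is cut between the parts refining successive cubes, at a time when the trace is
a vertex; each part then runs in the collar of its cube. -/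
theorem concatenates_of_steps {es : List X.Cell} {e : X.Cell} {ts : List I} {w : X.Cell}
    (P : X.Presentation p a b) (hes : Chain (tgt e) es w) (hstep : StepOn (trace p) a b)
    (hts : Steps (trace p) a ts b) (ha : trace p a = src e) (hb : src (trace p b) = trace p b)
    (h : RefinesList (e :: es) (nonVertices (ts.map (trace p)))) :
    Concatenates (X.RunsInCollar p) (e :: es) a b := by
  induction es generalizing a e ts with
  | nil =>
    rw [refinesList_singleton] at h
    exact ⟨b, hts.le, le_rfl, runsInCollar_of_steps P hstep hts ha hb h, rfl⟩
  | cons e' es ih =>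
    obtain ⟨l₁, l₂, heq, h1, h2⟩ := h
    obtain ⟨m, ts₁, ts₂, h3, h4, h5, rfl, rfl⟩ := hts.exists_cut (by rw [ha, src_src]) hb heq
    obtain ⟨P₁⟩ := P.restrict le_rfl h3.le h4.le
    obtain ⟨P₂⟩ := P.restrict h3.le h4.le le_rfl
    refine ⟨m, h3.le, h4.le, runsInCollar_of_steps P₁ (hstep.mono le_rfl h4.le) h3 ha h5 h1,
      ih P₂ hes.2.2 (hstep.mono h3.le le_rfl) h4 ?_ h2⟩
    -- The vertex at the cut is the end of the part refining `e`, that is, the target of `e` and the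
    -- source of `e'`.
    have h6 := h3.chain
    rw [ha, tgt_src, tgt_of_src _ h5] at h6
    rw [hes.2.1]
    exact h6.unique_right h1.chain

theorem trace_of_eq_vertexPt {t : I} {v : X.cube 0} (h : p t = X.vertexPt v) :
    trace p t = ⟨0, v⟩ := by rw [trace, h]; rfl

variable {x y : X.cube 0}

theorem CubeChain.pieces_of_ne {c : X.CubeChain x y} (h : c.cubes ≠ []) : c.pieces = c.cubes := by
  unfold pieces
  split
  · exact absurd ‹_› h
  · exact Eq.symm ‹_›

theorem CubeChain.pieces_of_eq {c : X.CubeChain x y} (h : c.cubes = []) : c.pieces = [⟨0, x⟩] := by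
  rw [pieces, h]

theorem strictPaths_stepOn {p : C(I, X.Realization)} (hp : p ∈ X.strictPaths x y) :
    StepOn (trace p) 0 1 := by
  obtain ⟨-, P, hP⟩ := hp
  exact hP.stepOn_trace

theorem strictPaths_steps {p : C(I, X.Realization)} (hp : p ∈ X.strictPaths x y) :
    ∃ ts, Steps (trace p) 0 ts 1 ∧ X.crossingCubes p = nonVertices (ts.map (trace p)) := by
  obtain ⟨ts, hts⟩ := (strictPaths_stepOn hp).exists_steps zero_le_one
  refine ⟨ts, hts, crossingCubes_eq hts ?_⟩
  rw [trace_of_eq_vertexPt hp.1.1]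
  rfl

/-- The crossed cubes of a strict path form a chain. -/
theorem exists_chain_of_strict {p : C(I, X.Realization)} (hp : p ∈ X.strictPaths x y) :
    ∃ cp : X.CubeChain x y, cp.cubes = X.crossingCubes p := by
  obtain ⟨ts, hts, heq⟩ := strictPaths_steps hp
  rw [heq]
  apply CubeChain.exists_of_chain
  have := hts.chain
  rwa [trace_of_eq_vertexPt hp.1.1, trace_of_eq_vertexPt hp.1.2.1] at this

/-- A strict path belongs to the collar path space of exactly those chains that are refined by its
own chain. -/
theorem mem_collarPaths_iff {p : C(I, X.Realization)} (hp : p ∈ X.strictPaths x y)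
    {c cp : X.CubeChain x y} (hcp : cp.cubes = X.crossingCubes p) :
    p ∈ X.collarPaths c ↔ cp.Refines c := by
  have hstep := strictPaths_stepOn hp
  have h0 : trace p 0 = ⟨0, x⟩ := trace_of_eq_vertexPt hp.1.1
  have h1 : trace p 1 = ⟨0, y⟩ := trace_of_eq_vertexPt hp.1.2.1
  have h0' : src (trace p 0) = trace p 0 := by rw [h0]; rfl
  have h1' : src (trace p 1) = trace p 1 := by rw [h1]; rfl
  rw [CubeChain.refines_iff, hcp]
  constructor
  · rintro ⟨-, h⟩
    -- For the empty chain the only piece is the vertex `x`; its refinements have total dimension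
    -- zero, so the path crosses no middle hyperplane.
    by_cases hc : c.cubes = []
    · rw [CubeChain.pieces_of_eq hc] at h
      obtain ⟨m, -, -, h, hm⟩ := h
      obtain rfl : m = 1 := hm
      obtain ⟨ts, h2, h3⟩ := h.exists_steps zero_lt_one hstep
      rw [crossingCubes_eq h2 h0', hc, refinesList_nil]
      by_contra hne
      obtain ⟨g, hg⟩ := List.exists_mem_of_ne_nil _ hne
      have h4 := List.single_le_sum (l := (nonVertices (ts.map (trace p))).map Sigma.fst)
        (by simp) g.1 (List.mem_map_of_mem hg)
      rw [h3.sum_dim] at h4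
      exact absurd h4 (not_le.mpr (h3.dim_pos g hg))
    · rw [CubeChain.pieces_of_ne hc] at h
      obtain ⟨ts, h2, h3⟩ := concatenates_exists_steps c.dim_pos hstep h
      rwa [crossingCubes_eq h2 h0']
  · intro h
    refine ⟨hp.1, ?_⟩
    obtain ⟨ts, hts, heq⟩ := strictPaths_steps hp
    obtain ⟨P⟩ := hp.1.2.2
    rw [heq] at h
    by_cases hc : c.cubes = []
    · rw [hc, refinesList_nil] at h
      rw [CubeChain.pieces_of_eq hc]
      refine concatenates_of_steps P (e := ⟨0, x⟩) rfl hstep hts (by rw [h0]; rfl) h1' ?_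
      rw [h, refinesList_singleton]
      exact refinesCell_nil_iff.mpr rfl
    · rw [CubeChain.pieces_of_ne hc]
      have hch := c.chain
      obtain ⟨e, es, hce⟩ := List.exists_cons_of_ne_nil hc
      rw [hce] at h hch ⊢
      exact concatenates_of_steps P hch.2.2 hstep hts (by rw [h0, hch.2.1]) h1' h

end PrecubicalSet

namespace PrecubicalSet

variable {X : PrecubicalSet.{u}}

/-! Every chain is the chain of a strict tame path -/

theorem continuous_pt {n : ℕ} (c : X.cube n) : Continuous (X.pt c) :=
  continuous_quot_mk.comp (@continuous_sigmaMk X.Cell (fun c => Fin c.1 → I) _ ⟨n, c⟩)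

theorem pt_const (α : Bool) : ∀ {n : ℕ} (c : X.cube n),
    X.pt c (fun _ => if α then 1 else 0) = X.vertexPt (X.endVertex α c) := by
  intro n
  induction n with
  | zero =>
    intro c
    exact congrArg (X.pt c) (Subsingleton.elim _ _)
  | succ n ih =>
    intro c
    refine Eq.trans ?_ (ih (X.face α 0 c))
    have := Quot.sound (Glue.glue c 0 α fun _ => if α then 1 else 0)
    refine Eq.trans ?_ this.symm
    refine congrArg (X.pt c) (funext fun i => ?_)
    refine Fin.cases ?_ (fun i => ?_) i <;> simp

namespace Presentation

variable {p q : I → X.Realization} {a b : I}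

/-- A presentation depends only on the values of the path on the interval. -/
def congr (P : X.Presentation p a b) (h : ∀ t ∈ Icc a b, q t = p t) : X.Presentation q a b where
  len := P.len
  time := P.time
  time_mono := P.time_mono
  time_zero := P.time_zero
  time_last := P.time_last
  dim := P.dim
  cube := P.cube
  path := P.path
  path_cont := P.path_cont
  path_mono := P.path_mono
  eq_pt k t ht := (h t ⟨(P.time_mem _).1.trans ht.1, ht.2.trans (P.time_mem _).2⟩).trans
    (P.eq_pt k t ht)

theorem IsTame.congr {P : X.Presentation p a b} (hP : P.IsTame)
    (h : ∀ t ∈ Icc a b, q t = p t) : (P.congr h).IsTame := fun k => by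
  obtain ⟨v, hv⟩ := hP k
  exact ⟨v, (h _ (P.time_mem k)).trans hv⟩

end Presentation

theorem exists_increasing {a m : I} (h : a < m) :
    ∃ d : I → I, Continuous d ∧ StrictMonoOn d (Icc a m) ∧ d a = 0 ∧ d m = 1 := by
  have h' : (0 : ℝ) < m - a := sub_pos.mpr h
  refine ⟨fun t => projIcc 0 1 zero_le_one (((t : ℝ) - a) / (m - a)), ?_, ?_, ?_, ?_⟩
  · exact continuous_projIcc.comp (by fun_prop)
  · intro s hs t ht hst
    have hmem : ∀ r ∈ Icc a m, ((r : ℝ) - a) / (m - a) ∈ Icc (0 : ℝ) 1 := by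
      intro r hr
      have h1 : (a : ℝ) ≤ r := hr.1
      have h2 : (r : ℝ) ≤ m := hr.2
      exact ⟨div_nonneg (by linarith) h'.le, (div_le_one h').mpr (by linarith)⟩
    refine strictMonoOn_projIcc _ (hmem s hs) (hmem t ht) ?_
    have : (s : ℝ) < t := hst
    exact div_lt_div_of_pos_right (by linarith) h'
  · simp
  · simp [div_self h'.ne']

/-- The diagonal meets all middle hyperplanes of `e` at one time `r`. The trace is `src e` before
`r`, the cube `e` at `r`, and `tgt e` afterwards. -/
theorem exists_diagonal (e : X.Cell) {a m : I} (h : a < m) :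
    ∃ d : I → I, Continuous d ∧ StrictMonoOn d (Icc a m) ∧
      X.pt e.2 (fun _ => d a) = X.vertexPt (X.endVertex false e.2) ∧
      X.pt e.2 (fun _ => d m) = X.vertexPt (X.endVertex true e.2) ∧
      ∀ p : I → X.Realization, (∀ t ∈ Icc a m, p t = X.pt e.2 fun _ => d t) →
        ∃ ts, Steps (trace p) a ts m ∧ ∀ (_ : 0 < e.1), nonVertices (ts.map (trace p)) = [e] := by
  obtain ⟨d, hd, hmono, ha, hm⟩ := exists_increasing h
  refine ⟨d, hd, hmono, ?_, ?_, fun p hp => ?_⟩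
  · rw [ha]; exact pt_const false e.2
  · rw [hm]; exact pt_const true e.2
  obtain ⟨r, hr, hdr⟩ : (⟨1 / 2, by norm_num, by norm_num⟩ : I) ∈ d '' Icc a m := by
    refine intermediate_value_Icc h.le hd.continuousOn ?_
    rw [ha, hm]
    exact ⟨bot_le, le_top⟩
  have hlt : ∀ t ∈ Icc a m, t < r → trace p t = src e := by
    intro t ht htr
    have h1 : (d t : ℝ) < 1 / 2 := by
      have := hmono ht hr htr
      rw [hdr] at this
      exact this
    rw [trace, hp t ht, nearestFace_pt]
    have : CubeFace.nearest (fun _ : Fin e.1 => d t) = CubeFace.corner e.1 false :=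
      funext fun i => CubeFace.nearest_of_lt h1
    rw [this, iterFace_corner]; rfl
  have hgt : ∀ t ∈ Icc a m, r < t → trace p t = tgt e := by
    intro t ht htr
    have h1 : 1 / 2 < (d t : ℝ) := by
      have := hmono hr ht htr
      rw [hdr] at this
      exact this
    rw [trace, hp t ht, nearestFace_pt]
    have : CubeFace.nearest (fun _ : Fin e.1 => d t) = CubeFace.corner e.1 true :=
      funext fun i => CubeFace.nearest_of_gt h1
    rw [this, iterFace_corner]; rfl
  have heq : trace p r = e := by
    rw [trace, hp r hr, nearestFace_pt]
    have : CubeFace.nearest (fun _ : Fin e.1 => d r) = fun _ => none :=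
      funext fun i => CubeFace.nearest_of_eq (by rw [hdr])
    rw [this, iterFace_none]
  have har : a < r := by
    refine lt_of_le_of_ne hr.1 ?_
    rintro rfl
    have := congrArg Subtype.val (ha.symm.trans hdr)
    norm_num at this
  have hrm : r < m := by
    refine lt_of_le_of_ne hr.2 ?_
    rintro rfl
    have := congrArg Subtype.val (hm.symm.trans hdr)
    norm_num at this
  have h1 : trace p a = src e := hlt a ⟨le_rfl, h.le⟩ har
  have h2 : trace p m = tgt e := hgt m ⟨h.le, le_rfl⟩ hrm
  refine ⟨[r, m], ⟨har, fun t ht => ?_, ?_, hrm, fun t ht => ?_, ?_, rfl⟩, fun he => ?_⟩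
  · rw [h1, tgt_src, hlt t ⟨ht.1.le, ht.2.le.trans hr.2⟩ ht.2]
  · rw [h1, heq, tgt_src]
  · rw [heq, hgt t ⟨hr.1.trans ht.1.le, ht.2.le⟩ ht.1]
  · rw [heq, h2, src_tgt]
  · rw [List.map_cons, heq, nonVertices_cons_of_ne (src_ne_self_iff.mpr he), List.map_cons, h2,
      nonVertices_cons_of_eq (src_tgt e), List.map_nil, nonVertices_nil]

/-- The diagonals of the cubes are concatenated. The subdivision points are vertices, which gives
tameness, and strictly increasing coordinates give strictness. -/
theorem exists_path_of_chain {x y : X.cube 0} {l : List X.Cell}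
    (h : Chain (⟨0, x⟩ : X.Cell) l ⟨0, y⟩) {a b : I} (hab : a < b) :
    ∃ p : I → X.Realization, Continuous p ∧ p a = X.vertexPt x ∧ p b = X.vertexPt y ∧
      (∃ P : X.Presentation p a b, P.IsStrict ∧ P.IsTame) ∧
      ∃ ts, Steps (trace p) a ts b ∧ nonVertices (ts.map (trace p)) = l := by
  induction l generalizing x a with
  | nil =>
    obtain rfl : x = y := by simpa [chain_nil] using h
    refine ⟨fun _ => X.vertexPt x, continuous_const, rfl, rfl, ?_, [b], ?_, ?_⟩
    -- The constant path is presented in the `0`-cube `x`, where strictness holds for lack of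
    -- coordinates.
    · refine ⟨(Presentation.nil _ b).cons hab.le x (fun _ => Fin.elim0) continuousOn_const
        monotoneOn_const fun _ _ => rfl, ?_, ?_⟩
      · exact Presentation.IsStrict.cons _ _ _ _ _ _ (fun k => k.elim0) fun i => i.elim0
      · exact Presentation.IsTame.cons _ _ _ _ _ _ (fun k => ⟨x, rfl⟩) ⟨x, rfl⟩
    · exact ⟨hab, fun _ _ => rfl, rfl, rfl⟩
    · exact nonVertices_cons_of_eq rfl
  | cons e l ih =>
    obtain ⟨h1, h2, h3⟩ := h
    obtain ⟨m, ham, hmb⟩ := exists_between hab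
    obtain ⟨q, hq, hqm, hqb, ⟨Q, hQs, hQt⟩, ts, hts, hl⟩ := ih (x := X.endVertex true e.2) h3 hmb
    obtain ⟨d, hd, hmono, hda, hdm, hdt⟩ := exists_diagonal e ham
    have hx : X.endVertex false e.2 = x := by
      have : (⟨0, X.endVertex false e.2⟩ : X.Cell) = ⟨0, x⟩ := h2
      simpa using this
    set p : I → X.Realization := fun t => if t ≤ m then X.pt e.2 (fun _ => d t) else q t with hp
    have hp1 : ∀ t ∈ Icc a m, p t = X.pt e.2 (fun _ => d t) := fun t ht => if_pos ht.2
    have hp2 : ∀ t ∈ Icc m b, p t = q t := by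
      intro t ht
      rcases ht.1.eq_or_lt with rfl | h4
      · rw [hp1 m ⟨ham.le, le_rfl⟩, hdm, hqm]
      · exact if_neg h4.not_ge
    have hpc : Continuous p := by
      refine Continuous.if_le ((continuous_pt e.2).comp (continuous_pi fun _ => hd)) hq
        continuous_id continuous_const ?_
      rintro t rfl
      rw [hqm, ← hdm]
    have hpa : p a = X.vertexPt x := by rw [hp1 a ⟨le_rfl, ham.le⟩, hda, hx]
    obtain ⟨ts', h5, h6⟩ := hdt p hp1
    have h7 := hts.map (F := trace p) id (fun _ => rfl) (fun _ => rfl) fun t ht => by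
      rw [trace, hp2 t ht]; rfl
    refine ⟨p, hpc, hpa, by rw [hp2 b ⟨hmb.le, le_rfl⟩, hqb], ?_, ts' ++ ts,
      steps_append.mpr ⟨m, h5, h7.1⟩, ?_⟩
    · have hdmono : MonotoneOn (fun t (_ : Fin e.1) => d t) (Icc a m) :=
        fun s hs t ht hst _ => hmono.monotoneOn hs ht hst
      refine ⟨(Q.congr hp2).cons ham.le e.2 (fun t _ => d t)
        (continuous_pi fun _ => hd).continuousOn hdmono hp1, ?_, ?_⟩
      · exact Presentation.IsStrict.cons _ _ _ _ _ _ hQs fun i s hs t ht h =>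
          hmono.injOn hs ht h
      · exact Presentation.IsTame.cons _ _ _ _ _ _ (hQt.congr hp2) ⟨x, hpa⟩
    · rw [List.map_append, nonVertices_append, h6 (src_ne_self_iff.mp h1), h7.2, List.map_id, hl]
      rfl

theorem exists_strictTamePath {x y : X.cube 0} (c : X.CubeChain x y) :
    ∃ p ∈ X.strictTamePaths x y, X.crossingCubes p = c.cubes := by
  obtain ⟨p, hp, h0, h1, ⟨P, hPs, hPt⟩, ts, hts, hl⟩ :=
    exists_path_of_chain c.chain (zero_lt_one (α := I))
  refine ⟨⟨p, hp⟩, ⟨⟨⟨h0, h1, ⟨P⟩⟩, P, hPs⟩, ⟨h0, h1, ⟨P⟩⟩, P, hPt⟩, ?_⟩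
  rw [← hl]
  refine crossingCubes_eq hts ?_
  change src (trace p 0) = trace p 0
  rw [trace_of_eq_vertexPt h0]
  rfl

/-! Collar path spaces of non-self-linked `□`-sets -/

/-- A point in `C_J` has its smallest cube among the faces of `d_J c`, and transfer makes it an
iterated face of `d`. Conversely the nearest face itself serves as `J`. -/
theorem mem_collar_iff {d : X.Cell} {z : X.Realization} :
    z ∈ X.collar d ↔ ∃ K : CubeFace d.1, X.nearestFace z = X.iterFace K d.2 := by
  constructor
  · rintro ⟨n, c, J, x, rfl, hx, K, hJK⟩
    obtain ⟨φ⟩ := X.exists_orderIso_of_eq hJK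
    exact ⟨_, (X.iterFace_transfer φ hJK (CubeFace.mem_collar_iff.mp hx)).symm⟩
  · induction z using Quot.ind with
    | mk z =>
      obtain ⟨⟨n, c⟩, x⟩ := z
      rintro ⟨K, hK⟩
      exact ⟨n, c, CubeFace.nearest x, x, rfl,
        CubeFace.mem_collar_iff.mpr (CubeFace.IsSubface.refl _), K, hK⟩

theorem mem_star_iff {v : X.cube 0} {z : X.Realization} :
    z ∈ X.star v ↔ X.nearestFace z = ⟨0, v⟩ :=
  mem_collar_iff.trans ⟨fun ⟨_, h⟩ => h, fun h => ⟨Fin.elim0, h⟩⟩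

variable {p : I → X.Realization} {a b : I}

theorem RunsInCollar.staysInCollar {e : X.Cell} (h : X.RunsInCollar p e a b) (hab : a < b) :
    X.StaysInCollar p e a b := by
  obtain ⟨F, h1, h2, h3, -⟩ := h.exists_face hab
  refine ⟨fun t ht => mem_collar_iff.mpr ⟨F t, h3 t ht⟩, mem_star_iff.mpr ?_, mem_star_iff.mpr ?_⟩
  · rw [← iterFace_corner, ← h1]
    exact h3 a ⟨le_rfl, hab.le⟩
  · rw [← iterFace_corner, ← h2]
    exact h3 b ⟨hab.le, le_rfl⟩

/-- Without self-links the face `F t` is determined by the trace, so faces chosen pointwise agree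
with the local description by transfer. Openness of collars supplies the neighbourhoods. -/
theorem StaysInCollar.runsInCollar (hX : X.NonSelfLinked) {e : X.Cell}
    (h : X.StaysInCollar p e a b) (hab : a ≤ b) (P : X.Presentation p a b) :
    X.RunsInCollar p e a b := by
  obtain ⟨h1, h2, h3⟩ := h
  have hF : ∀ t, ∃ K : CubeFace e.1, t ∈ Icc a b → trace p t = X.iterFace K e.2 := by
    intro t
    by_cases ht : t ∈ Icc a b
    · obtain ⟨K, hK⟩ := mem_collar_iff.mp (h1 t ht)
      exact ⟨K, fun _ => hK⟩
    · exact ⟨fun _ => none, fun h => absurd h ht⟩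
  choose F hF using hF
  have huniq : ∀ t ∈ Icc a b, ∀ K : CubeFace e.1, trace p t = X.iterFace K e.2 → F t = K :=
    fun t ht K hK => hX e.1 e.2 ((hF t ht).symm.trans hK)
  refine ⟨P, F, huniq a ⟨le_rfl, hab⟩ _ ?_, huniq b ⟨hab, le_rfl⟩ _ ?_, fun k s hs => ?_⟩
  · rw [iterFace_corner]; exact mem_star_iff.mp h2
  · rw [iterFace_corner]; exact mem_star_iff.mp h3
  have hsub : Icc (P.time k.castSucc) (P.time k.succ) ⊆ Icc a b :=
    Icc_subset_Icc (P.time_mem _).1 (P.time_mem _).2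
  have hJK : X.iterFace (CubeFace.nearest (P.path k s)) (P.cube k) = X.iterFace (F s) e.2 := by
    rw [← P.trace_eq k hs, hF s (hsub hs)]
  obtain ⟨φ⟩ := X.exists_orderIso_of_eq hJK
  refine ⟨_, _, φ, hJK, ?_⟩
  have hcol : ∀ᶠ t in 𝓝[Icc (P.time k.castSucc) (P.time k.succ)] s,
      P.path k t ∈ CubeFace.collar (CubeFace.nearest (P.path k s)) :=
    P.path_cont k s hs ((CubeFace.isOpen_collar _).mem_nhds
      (CubeFace.mem_collar_iff.mpr (CubeFace.IsSubface.refl _)))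
  filter_upwards [hcol, self_mem_nhdsWithin] with t ht1 ht2
  refine ⟨ht1, huniq t (hsub ht2) _ ?_⟩
  rw [X.iterFace_transfer φ hJK (CubeFace.mem_collar_iff.mp ht1), P.trace_eq k ht2]

theorem Concatenates.imp {Q Q' : X.Cell → I → I → Prop} {es : List X.Cell} {c d : I}
    (h : Concatenates Q es a b) (hca : c ≤ a) (hbd : b ≤ d)
    (hQ : ∀ e ∈ es, ∀ s t, c ≤ s → s ≤ t → t ≤ d → Q e s t → Q' e s t) :
    Concatenates Q' es a b := by
  induction es generalizing a with
  | nil => exact h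
  | cons e es ih =>
    obtain ⟨m, h1, h2, h3, h4⟩ := h
    exact ⟨m, h1, h2, hQ e (by simp) a m hca h1 (h2.trans hbd) h3,
      ih h4 (hca.trans h1) fun e he => hQ e (by simp [he])⟩

theorem NonSelfLinked.collarPaths_eq (hX : X.NonSelfLinked) {x y : X.cube 0}
    (c : X.CubeChain x y) : X.collarPaths c = X.plainCollarPaths c := by
  ext p
  refine and_congr_right fun hp => ⟨fun h => ?_, fun h => ?_⟩
  · by_cases hc : c.cubes = []
    · rw [CubeChain.pieces_of_eq hc] at h ⊢
      obtain ⟨m, h1, h2, h3, hm⟩ := h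
      obtain rfl : m = 1 := hm
      exact ⟨1, h1, h2, h3.staysInCollar zero_lt_one, rfl⟩
    · rw [CubeChain.pieces_of_ne hc] at h ⊢
      exact h.imp le_rfl le_rfl fun e he s t _ hst _ hQ =>
        hQ.staysInCollar (lt_of_le_of_ne hst (hQ.ne (c.dim_pos e he)))
  · obtain ⟨P⟩ := hp.2.2
    refine h.imp le_rfl le_rfl fun e _ s t h0 hst h1 hQ => ?_
    obtain ⟨Q⟩ := P.restrict h0 hst h1
    exact hQ.runsInCollar hX hst Q

end PrecubicalSet

/-! ### The proposition -/

theorem mainTheorem8 (X : PrecubicalSet.{u}) (x y : X.cube 0) :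
    -- all assertions hold for strict paths and for strict tame paths
    (∀ A : Set C(unitInterval, X.Realization),
      (A = X.strictPaths x y ∨ A = X.strictTamePaths x y) →
      -- refinement and inclusion
      (∀ c c' : X.CubeChain x y,
        c'.Refines c ↔ A ∩ X.collarPaths c' ⊆ A ∩ X.collarPaths c) ∧
      -- proper refinement and proper inclusion
      (∀ c c' : X.CubeChain x y, c'.Refines c → c' ≠ c →
        A ∩ X.collarPaths c' ⊂ A ∩ X.collarPaths c) ∧
      -- the chain of a path is the finest chain whose collar path space contains the path
      (∀ p ∈ A, ∃ cp : X.CubeChain x y, cp.cubes = X.crossingCubes p ∧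
        p ∈ A ∩ X.collarPaths cp ∧
        ∀ c : X.CubeChain x y, p ∈ A ∩ X.collarPaths c → cp.Refines c) ∧
      -- intersection and common refinement
      (∀ c c' : X.CubeChain x y,
        ((A ∩ X.collarPaths c) ∩ (A ∩ X.collarPaths c')).Nonempty ↔
          ∃ d : X.CubeChain x y, d.IsCommonRefinement c c') ∧
      (∀ c c' d : X.CubeChain x y, d.IsCommonRefinement c c' →
        A ∩ X.collarPaths d ⊆ (A ∩ X.collarPaths c) ∩ (A ∩ X.collarPaths c')) ∧
      (∀ c c' d : X.CubeChain x y, d.IsCoarsestCommonRefinement c c' →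
        A ∩ X.collarPaths d = (A ∩ X.collarPaths c) ∩ (A ∩ X.collarPaths c')) ∧
      -- existence of coarsest common refinements
      (X.IsProper → X.NonSelfLinked → ∀ c c' : X.CubeChain x y,
        (¬ ∃ d : X.CubeChain x y, d.IsCommonRefinement c c') ∨
        ∃ d : X.CubeChain x y, d.IsCoarsestCommonRefinement c c' ∧
          A ∩ X.collarPaths d = (A ∩ X.collarPaths c) ∩ (A ∩ X.collarPaths c'))) ∧
    -- without self-links, collar path spaces can be described by subsets of the realization
    (X.NonSelfLinked → ∀ c : X.CubeChain x y, X.collarPaths c = X.plainCollarPaths c) := by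
  refine ⟨fun A hA => ?_, fun hX c => hX.collarPaths_eq c⟩
  -- Both cases are covered by the inclusions `strictTamePaths ⊆ A ⊆ strictPaths`: paths in `A` have
  -- chains, and every chain is realized in `A`.
  have hAs : A ⊆ X.strictPaths x y := by
    rcases hA with rfl | rfl
    · exact subset_rfl
    · exact inter_subset_left
  have hAt : X.strictTamePaths x y ⊆ A := by
    rcases hA with rfl | rfl
    · exact inter_subset_left
    · exact subset_rfl
  -- the chain of a path in `A`
  have hchain : ∀ p ∈ A, ∃ cp : X.CubeChain x y, cp.cubes = X.crossingCubes p ∧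
      ∀ c : X.CubeChain x y, p ∈ A ∩ X.collarPaths c ↔ cp.Refines c := by
    intro p hp
    obtain ⟨cp, hcp⟩ := PrecubicalSet.exists_chain_of_strict (hAs hp)
    exact ⟨cp, hcp, fun c =>
      (and_iff_right hp).trans (PrecubicalSet.mem_collarPaths_iff (hAs hp) hcp)⟩
  -- a path in `A` with given chain
  have hpath : ∀ d : X.CubeChain x y, ∃ p ∈ A,
      ∀ c : X.CubeChain x y, p ∈ A ∩ X.collarPaths c ↔ d.Refines c := by
    intro d
    obtain ⟨p, hp, hd⟩ := PrecubicalSet.exists_strictTamePath d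
    exact ⟨p, hAt hp, fun c => (and_iff_right (hAt hp)).trans
      (PrecubicalSet.mem_collarPaths_iff (hAs (hAt hp)) hd.symm)⟩
  have hrefl : ∀ c : X.CubeChain x y, c.Refines c := fun c => Relation.ReflTransGen.refl
  have hmono : ∀ c c' : X.CubeChain x y,
      c'.Refines c ↔ A ∩ X.collarPaths c' ⊆ A ∩ X.collarPaths c := by
    intro c c'
    constructor
    · intro h p hp
      obtain ⟨cp, -, hcp⟩ := hchain p hp.1
      rw [hcp] at hp ⊢
      exact h.trans hp
    · intro h
      -- A path whose own chain is `c'` tests the inclusion.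
      obtain ⟨p, -, hp⟩ := hpath c'
      exact (hp c).mp (h ((hp c').mpr (hrefl c')))
  have hsub : ∀ c c' d : X.CubeChain x y, d.IsCommonRefinement c c' →
      A ∩ X.collarPaths d ⊆ (A ∩ X.collarPaths c) ∩ (A ∩ X.collarPaths c') :=
    fun c c' d h => subset_inter ((hmono c d).mp h.1) ((hmono c' d).mp h.2)
  have hcoarsest : ∀ c c' d : X.CubeChain x y, d.IsCoarsestCommonRefinement c c' →
      A ∩ X.collarPaths d = (A ∩ X.collarPaths c) ∩ (A ∩ X.collarPaths c') := by
    intro c c' d h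
    refine (hsub c c' d h.1).antisymm fun p hp => ?_
    obtain ⟨cp, -, hcp⟩ := hchain p hp.1.1
    exact (hcp d).mpr (h.2 cp ⟨(hcp c).mp hp.1, (hcp c').mp hp.2⟩)
  refine ⟨hmono, fun c c' h hne => ⟨(hmono c c').mp h, fun h' => ?_⟩, fun p hp => ?_,
    fun c c' => ⟨?_, ?_⟩, hsub, hcoarsest, fun hX _ c c' => ?_⟩
  · exact hne (h.antisymm ((hmono c' c).mpr h'))
  · obtain ⟨cp, h1, hcp⟩ := hchain p hp
    exact ⟨cp, h1, (hcp cp).mpr (hrefl cp), fun c => (hcp c).mp⟩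
  · rintro ⟨p, hp, hp'⟩
    obtain ⟨cp, -, hcp⟩ := hchain p hp.1
    exact ⟨cp, (hcp c).mp hp, (hcp c').mp hp'⟩
  · rintro ⟨d, hd⟩
    obtain ⟨p, -, hp⟩ := hpath d
    exact ⟨p, hsub c c' d hd ((hp d).mpr (hrefl d))⟩
  · by_cases h : ∃ d : X.CubeChain x y, d.IsCommonRefinement c c'
    · obtain ⟨d, hd⟩ := h
      obtain ⟨E, hE⟩ := hX.exists_isCoarsestCommonRefinement hd
      exact Or.inr ⟨E, hE, hcoarsest c c' E hE⟩
    · exact Or.inl h
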